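/- **Notation.** For a positive definite $S\in\mathbb R^{k\times k}$ let $\phi_k(\cdot\,;S)$ and $\Phi_k(\cdot\,;S)$ be the density and the distribution function of $N(0,S)$ (with $\Phi_0=\phi_0=1$), $D_S$ the diagonal matrix of the square roots of the diagonal entries of $S$, and $\bar S=D_S^{-1}SD_S^{-1}$. The unified skew-normal law $\mathrm{SUN}_{p,s}(\xi,\Omega,\Delta,\gamma,\Gamma)$ on $\mathbb R^p$ has the density $$z\mapsto\phi_p(z-\xi;\Omega)\,\frac{\Phi_s\big(\gamma+\Delta^T\bar\Omega^{-1}D_\Omega^{-1}(z-\xi);\ \Gamma-\Delta^T\bar\Omega^{-1}\Delta\big)}{\Phi_s(\gamma;\Gamma)} .$$ Given functions $\xi:\mathbb R^d\to\mathbb R$, $\Omega:\mathbb R^d\times\mathbb R^d\to\mathbb R$, $\Delta:\mathbb R^d\to\mathbb R^s$ and $\gamma\in\mathbb R^s$, $\Gamma\in\mathbb R^{s\times s}$, write $\xi(X)=(\xi(x_i))_i$, $\Omega(X,X)=(\Omega(x_i,x_j))_{ij}$, and let $\Delta(X)$ be the matrix with rows $\Delta(x_i)$, for $X=(x_1,\dots,x_n)$.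 A process $f$ on $\mathbb R^d$ is $\mathrm{SkewGP}_s(\xi,\Omega,\Delta,\gamma,\Gamma)$ if for all finitely many distinct points $X=(x_1,\dots,x_n)$ the matrix $\begin{bmatrix}\Gamma&\Delta(X)^T\\ \Delta(X)&\bar\Omega(X,X)\end{bmatrix}$ is positive definite and $f(X)=(f(x_1),\dots,f(x_n))\sim\mathrm{SUN}_{n,s}(\xi(X),\Omega(X,X),\Delta(X),\gamma,\Gamma)$. **Theorem.** Let $f\sim\mathrm{SkewGP}_s(\xi,\Omega,\Delta,\gamma,\Gamma)$ on $\mathbb R^d$, let $X=(x_1,\dots,x_n)$ be distinct points of $\mathbb R^d$, let $W\in\mathbb R^{m_a\times n}$, $Z\in\mathbb R^{m_a}$, $C\in\mathbb R^{m_r\times n}$, $Y\in\mathbb R^{m_r}$, and let $\Sigma\in\mathbb R^{m_a\times m_a}$ and $R\in\mathbb R^{m_r\times m_r}$ be symmetric positive definite. Then under the posterior for the likelihood $$p(Y,Z,W\mid f(X))=\Phi_{m_a}(Z+Wf(X);\Sigma)\,\phi_{m_r}(Y-Cf(X);R)$$ (the probability measure whose density with respect to the prior is proportional to this likelihood), $f\sim\mathrm{SkewGP}_{s+m_a}(\tilde\xi,\tilde\Omega,\tilde\Delta,\tilde\gamma,\tilde\Gamma)$.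 Here, with $G=(C\Omega(X,X)C^T+R)^{-1}$, $D=D_{\Omega(X,X)}$ and $B=\begin{bmatrix}\Delta(X)&D^{-1}\Omega(X,X)W^T\end{bmatrix}$, $$\begin{aligned} \tilde\xi(x)&=\xi(x)+\Omega(x,X)C^TG\,(Y-C\xi(X)),\\ \tilde\Omega(x,x')&=\Omega(x,x')-\Omega(x,X)C^TG\,C\,\Omega(X,x'),\\ \tilde\Delta(x)&=\tilde\Omega(x,x)^{-1/2}\Big(\Omega(x,x)^{1/2}\begin{bmatrix}\Delta(x)&\Omega(x,x)^{-1/2}\,\Omega(x,X)W^T\end{bmatrix}-\Omega(x,X)C^TG\,C\,D\,B\Big)\quad\text{(row vectors)},\\ \tilde\gamma&=\gamma_p+B^T\bar\Omega(X,X)^{-1}D^{-1}\big(\tilde\xi(X)-\xi(X)\big),\\ \tilde\Gamma&=\Gamma_p-B^T\bar\Omega(X,X)^{-1}B+\Delta_p^T\,\bar{\tilde\Omega}(X,X)^{-1}\Delta_p, \end{aligned}$$ where $$\gamma_p=\begin{bmatrix}\gamma\\ Z+W\xi(X)\end{bmatrix},\qquad \Gamma_p=\begin{bmatrix}\Gamma&\Delta(X)^TDW^T\\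 WD\Delta(X)&W\Omega(X,X)W^T+\Sigma\end{bmatrix},\qquad \Delta_p=\bar{\tilde\Omega}(X,X)\,D_{\tilde\Omega(X,X)}\,D^{-1}\,\bar\Omega(X,X)^{-1}B,$$ and $\bar{\tilde\Omega}(X,X)$ is the correlation matrix of $\tilde\Omega(X,X)$. -/

import Mathlib

open MeasureTheory

namespace SkewGP

/-- The density `φ(z; S)` of the centred multivariate normal distribution with covariance `S`. -/
noncomputable def normalPDF {ι : Type*} [Fintype ι] [DecidableEq ι]
    (z : ι → ℝ) (S : Matrix ι ι ℝ) : ℝ :=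
  (Real.sqrt ((2 * Real.pi) ^ Fintype.card ι * S.det))⁻¹ *
    Real.exp (-(1 / 2) * (z ⬝ᵥ (S⁻¹).mulVec z))

/-- The cumulative distribution function `Φ(a; S)` of the centred multivariate normal
distribution with covariance `S`. The order on `ι → ℝ` is the coordinatewise one. For an empty
index type it is the constant `1`. -/
noncomputable def normalCDF {ι : Type*} [Fintype ι] [DecidableEq ι]
    (a : ι → ℝ) (S : Matrix ι ι ℝ) : ℝ :=
  ∫ u in Set.Iic a, normalPDF u S

/-- The diagonal matrix `D_S` of the square roots of the diagonal entries of `S`. -/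
noncomputable def sdDiag {ι : Type*} [DecidableEq ι] (S : Matrix ι ι ℝ) : Matrix ι ι ℝ :=
  Matrix.diagonal fun i => Real.sqrt (S i i)

/-- The correlation matrix `D_S⁻¹ S D_S⁻¹` of `S`, so that `S = D_S * corr S * D_S`. -/
noncomputable def corr {ι : Type*} [Fintype ι] [DecidableEq ι] (S : Matrix ι ι ℝ) :
    Matrix ι ι ℝ :=
  (sdDiag S)⁻¹ * S * (sdDiag S)⁻¹

/-- The density of the unified skew-normal distribution `SUN(ξ, Ω, Δ, γ, Γ)` on `ι → ℝ`, with
latent coordinates indexed by `κ` (the latent dimension is the cardinality of `κ`). -/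
noncomputable def sunPDF {ι κ : Type*} [Fintype ι] [DecidableEq ι] [Fintype κ] [DecidableEq κ]
    (ξ : ι → ℝ) (Om : Matrix ι ι ℝ) (Δ : Matrix ι κ ℝ) (γ : κ → ℝ) (Γ : Matrix κ κ ℝ)
    (z : ι → ℝ) : ℝ :=
  normalPDF (z - ξ) Om *
    (normalCDF (γ + (Δ.transpose * (corr Om)⁻¹ * (sdDiag Om)⁻¹).mulVec (z - ξ))
        (Γ - Δ.transpose * (corr Om)⁻¹ * Δ) /
      normalCDF γ Γ)

/-- The unified skew-normal distribution, as the measure with density `sunPDF`. -/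
noncomputable def sun {ι κ : Type*} [Fintype ι] [DecidableEq ι] [Fintype κ] [DecidableEq κ]
    (ξ : ι → ℝ) (Om : Matrix ι ι ℝ) (Δ : Matrix ι κ ℝ) (γ : κ → ℝ) (Γ : Matrix κ κ ℝ) :
    Measure (ι → ℝ) :=
  volume.withDensity fun z => ENNReal.ofReal (sunPDF ξ Om Δ γ Γ z)

/-- The parameters of a skew Gaussian process indexed by the points of `E`, with latent
coordinates indexed by `κ`: location function `ξ`, scale function (kernel) `Ω`, skewness
function `Δ`, and latent parameters `γ`, `Γ`. -/
structure Params (E κ : Type*) where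
  loc : E → ℝ
  scale : E → E → ℝ
  skew : E → κ → ℝ
  gamma : κ → ℝ
  Gamma : Matrix κ κ ℝ

namespace Params

variable {E κ : Type*}

/-- The vector `ξ(X)`. -/
def locVec (θ : Params E κ) {n : ℕ} (X : Fin n → E) : Fin n → ℝ := fun i => θ.loc (X i)

/-- The matrix `Ω(X, X)`. -/
def scaleMat (θ : Params E κ) {n : ℕ} (X : Fin n → E) : Matrix (Fin n) (Fin n) ℝ :=
  Matrix.of fun i j => θ.scale (X i) (X j)

/-- The matrix `Δ(X)`, whose `i`-th row is `Δ(xᵢ)`. -/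
def skewMat (θ : Params E κ) {n : ℕ} (X : Fin n → E) : Matrix (Fin n) κ ℝ :=
  Matrix.of fun i => θ.skew (X i)

/-- The parameters are admissible: for all finitely many distinct points `X` the matrix
`[Γ, Δ(X)ᵀ; Δ(X), Ω̄(X, X)]` is (symmetric) positive definite. -/
def Admissible (θ : Params E κ) : Prop :=
  ∀ (n : ℕ) (X : Fin n → E), Function.Injective X →
    (Matrix.fromBlocks θ.Gamma (θ.skewMat X).transpose (θ.skewMat X)
      (corr (θ.scaleMat X))).PosDef

end Params

/-- Under the measure `P`, the stochastic process `f` is a skew Gaussian process with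
parameters `θ`: at any finitely many distinct points it has the corresponding unified
skew-normal distribution. -/
structure IsSkewGP {E κ T : Type*} [Fintype κ] [DecidableEq κ] [MeasurableSpace T]
    (f : E → T → ℝ) (θ : Params E κ) (P : Measure T) : Prop where
  isProbabilityMeasure : IsProbabilityMeasure P
  measurable : ∀ x, Measurable (f x)
  admissible : θ.Admissible
  map_eq : ∀ (n : ℕ) (X : Fin n → E), Function.Injective X →
    P.map (fun t i => f (X i) t) =
      sun (θ.locVec X) (θ.scaleMat X) (θ.skewMat X) θ.gamma θ.Gamma

/-- Bayes' rule: the posterior of the prior `P` for the likelihood `ℓ` has density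
`ℓ / ∫ ℓ dP` with respect to `P`. -/
noncomputable def posterior {T : Type*} [MeasurableSpace T] (P : Measure T) (ℓ : T → ℝ) :
    Measure T :=
  (∫⁻ t, ENNReal.ofReal (ℓ t) ∂P)⁻¹ • P.withDensity fun t => ENNReal.ofReal (ℓ t)

/-- The data of a mixed likelihood `Φ(Z + W f(X); Σ) φ(Y - C f(X); R)`. -/
structure MixedData (E : Type*) (n ma mr : ℕ) where
  X : Fin n → E
  W : Matrix (Fin ma) (Fin n) ℝ
  Z : Fin ma → ℝ
  Sig : Matrix (Fin ma) (Fin ma) ℝ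
  C : Matrix (Fin mr) (Fin n) ℝ
  Y : Fin mr → ℝ
  R : Matrix (Fin mr) (Fin mr) ℝ

namespace MixedData

variable {E κ : Type*} {n ma mr : ℕ}

/-- The mixed likelihood, as a function of the vector `v = f(X)`. -/
noncomputable def likelihood (𝒟 : MixedData E n ma mr) (v : Fin n → ℝ) : ℝ :=
  normalCDF (𝒟.Z + 𝒟.W.mulVec v) 𝒟.Sig * normalPDF (𝒟.Y - 𝒟.C.mulVec v) 𝒟.R

/-- The row vector `Ω(x, X)`. -/
def crossScale (𝒟 : MixedData E n ma mr) (θ : Params E κ) (x : E) : Fin n → ℝ :=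
  fun i => θ.scale x (𝒟.X i)

/-- The matrix `Cᵀ (C Ω(X, X) Cᵀ + R)⁻¹`. -/
noncomputable def gain (𝒟 : MixedData E n ma mr) (θ : Params E κ) :
    Matrix (Fin n) (Fin mr) ℝ :=
  𝒟.C.transpose * (𝒟.C * θ.scaleMat 𝒟.X * 𝒟.C.transpose + 𝒟.R)⁻¹

/-- `ξ̃(x) = ξ(x) + Ω(x, X) Cᵀ (C Ω(X, X) Cᵀ + R)⁻¹ (Y - C ξ(X))`. -/
noncomputable def postLoc (𝒟 : MixedData E n ma mr) (θ : Params E κ) (x : E) : ℝ :=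
  θ.loc x +
    𝒟.crossScale θ x ⬝ᵥ (𝒟.gain θ).mulVec (𝒟.Y - 𝒟.C.mulVec (θ.locVec 𝒟.X))

/-- `Ω̃(x, x') = Ω(x, x') - Ω(x, X) Cᵀ (C Ω(X, X) Cᵀ + R)⁻¹ C Ω(X, x')`. -/
noncomputable def postScale (𝒟 : MixedData E n ma mr) (θ : Params E κ) (x x' : E) : ℝ :=
  θ.scale x x' -
    𝒟.crossScale θ x ⬝ᵥ (𝒟.gain θ * 𝒟.C).mulVec (fun i => θ.scale (𝒟.X i) x')

/-- The matrix `Ω̃(X, X)` at the input points. -/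
noncomputable def postScaleMat (𝒟 : MixedData E n ma mr) (θ : Params E κ) :
    Matrix (Fin n) (Fin n) ℝ :=
  Matrix.of fun i j => 𝒟.postScale θ (𝒟.X i) (𝒟.X j)

/-- The row vector `[Δ(x), D_{Ω(x,x)}⁻¹ Ω(x, X) Wᵀ]`. -/
noncomputable def affSkew (𝒟 : MixedData E n ma mr) (θ : Params E κ) (x : E) :
    κ ⊕ Fin ma → ℝ :=
  Sum.elim (θ.skew x)
    ((Real.sqrt (θ.scale x x))⁻¹ • Matrix.vecMul (𝒟.crossScale θ x) 𝒟.W.transpose)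

/-- The matrix `[Δ(X), D_{Ω(X,X)}⁻¹ Ω(X, X) Wᵀ]`. -/
noncomputable def affSkewMat (𝒟 : MixedData E n ma mr) (θ : Params E κ) :
    Matrix (Fin n) (κ ⊕ Fin ma) ℝ :=
  Matrix.fromCols (θ.skewMat 𝒟.X)
    ((sdDiag (θ.scaleMat 𝒟.X))⁻¹ * θ.scaleMat 𝒟.X * 𝒟.W.transpose)

/-- `γ_p = [γ, Z + W ξ(X)]`. -/
def affGamma (𝒟 : MixedData E n ma mr) (θ : Params E κ) : κ ⊕ Fin ma → ℝ :=
  Sum.elim θ.gamma (𝒟.Z + 𝒟.W.mulVec (θ.locVec 𝒟.X))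

/-- `Γ_p = [Γ, Δ(X)ᵀ D Wᵀ; W D Δ(X), W Ω(X, X) Wᵀ + Σ]` with `D = D_{Ω(X,X)}`. -/
noncomputable def affGammaMat (𝒟 : MixedData E n ma mr) (θ : Params E κ) :
    Matrix (κ ⊕ Fin ma) (κ ⊕ Fin ma) ℝ :=
  Matrix.fromBlocks θ.Gamma
    ((θ.skewMat 𝒟.X).transpose * sdDiag (θ.scaleMat 𝒟.X) * 𝒟.W.transpose)
    (𝒟.W * sdDiag (θ.scaleMat 𝒟.X) * θ.skewMat 𝒟.X)
    (𝒟.W * θ.scaleMat 𝒟.X * 𝒟.W.transpose + 𝒟.Sig)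

/-- `Δ̃(x) = D_{Ω̃(x,x)}⁻¹ D_{Ω(x,x)} [Δ(x), D_{Ω(x,x)}⁻¹ Ω(x, X) Wᵀ]
- D_{Ω̃(x,x)}⁻¹ Ω(x, X) Cᵀ (C Ω(X, X) Cᵀ + R)⁻¹ C D_{Ω(X,X)} [Δ(X), D_{Ω(X,X)}⁻¹ Ω(X, X) Wᵀ]`. -/
noncomputable def postSkew (𝒟 : MixedData E n ma mr) (θ : Params E κ) (x : E) :
    κ ⊕ Fin ma → ℝ :=
  ((Real.sqrt (𝒟.postScale θ x x))⁻¹ * Real.sqrt (θ.scale x x)) • 𝒟.affSkew θ x -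
    (Real.sqrt (𝒟.postScale θ x x))⁻¹ •
      Matrix.vecMul (𝒟.crossScale θ x)
        (𝒟.gain θ * 𝒟.C * sdDiag (θ.scaleMat 𝒟.X) * 𝒟.affSkewMat θ)

/-- `γ̃ = γ_p + [Δ(X), D⁻¹ Ω(X, X) Wᵀ]ᵀ Ω̄(X, X)⁻¹ D⁻¹ (ξ̃(X) - ξ(X))` with `D = D_{Ω(X,X)}`. -/
noncomputable def postGamma (𝒟 : MixedData E n ma mr) (θ : Params E κ) : κ ⊕ Fin ma → ℝ :=
  𝒟.affGamma θ +
    ((𝒟.affSkewMat θ).transpose * (corr (θ.scaleMat 𝒟.X))⁻¹ *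
      (sdDiag (θ.scaleMat 𝒟.X))⁻¹).mulVec
        ((fun i => 𝒟.postLoc θ (𝒟.X i)) - θ.locVec 𝒟.X)

/-- The matrix `Δ_p`, i.e. the correlation matrix of `Ω̃(X, X)` times
`D_{Ω̃(X,X)} D_{Ω(X,X)}⁻¹ Ω̄(X, X)⁻¹ [Δ(X), D_{Ω(X,X)}⁻¹ Ω(X, X) Wᵀ]`. -/
noncomputable def postSkewMat (𝒟 : MixedData E n ma mr) (θ : Params E κ) :
    Matrix (Fin n) (κ ⊕ Fin ma) ℝ :=
  corr (𝒟.postScaleMat θ) * sdDiag (𝒟.postScaleMat θ) * (sdDiag (θ.scaleMat 𝒟.X))⁻¹ *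
    (corr (θ.scaleMat 𝒟.X))⁻¹ * 𝒟.affSkewMat θ

/-- `Γ̃ = Γ_p - Bᵀ Ω̄(X, X)⁻¹ B + Δ_pᵀ Q⁻¹ Δ_p`, where `B = [Δ(X), D_{Ω(X,X)}⁻¹ Ω(X, X) Wᵀ]`
and `Q` is the correlation matrix of `Ω̃(X, X)`. -/
noncomputable def postGammaMat (𝒟 : MixedData E n ma mr) (θ : Params E κ) :
    Matrix (κ ⊕ Fin ma) (κ ⊕ Fin ma) ℝ :=
  𝒟.affGammaMat θ -
      (𝒟.affSkewMat θ).transpose * (corr (θ.scaleMat 𝒟.X))⁻¹ * 𝒟.affSkewMat θ +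
    (𝒟.postSkewMat θ).transpose * (corr (𝒟.postScaleMat θ))⁻¹ * 𝒟.postSkewMat θ

/-- The posterior parameters; the latent coordinates are the old ones followed by one for each
coordinate of the affine probit term. -/
noncomputable def postParams (𝒟 : MixedData E n ma mr) (θ : Params E κ) :
    Params E (κ ⊕ Fin ma) where
  loc := 𝒟.postLoc θ
  scale := 𝒟.postScale θ
  skew := 𝒟.postSkew θ
  gamma := 𝒟.postGamma θ
  Gamma := 𝒟.postGammaMat θ

end MixedData

end SkewGP

/-! Put `K = D Δ(X)`. A unified skew-normal vector is `V + ξ` conditioned on `U ≤ γ`, where `(U, V)`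
is centred normal with covariance blocks `Γ`, `-Kᵀ`, `-K`, `Ω` (`sun_eq_map`). Total mass one and
closure under marginals are therefore inherited from the normal law, and admissibility says exactly
that this joint covariance is positive definite (`posDef_corr_blocks_iff`).

At a tuple of points carrying the data, Bayes' rule is a pointwise identity of densities
(`posterior_sun`). The normal factor of the likelihood is conjugate to the normal density of `V`:
completing the square gives `ξ̃` and `Ω̃`. The probit factor adds the latent vector `U' = ε - W V`
with independent noise `ε` of covariance `Σ`. Given `V`, the vectors `U` and `U'` are independent,
so the product of the two distribution functions is one distribution function with block diagonal
covariance. Conditioning on the Gaussian observations changes the law of `V`, but neither the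
regression of `(U, U')` on `V` nor the residual covariance; this is what `Δ̃`, `γ̃` and `Γ̃` encode
(`regression`, `schur`). The normalising constant need not be computed, because the candidate
density is already known to have mass one.

For arbitrary points `X'`, take distinct points containing both `X'` and the data points, and
rewrite the data there with `W S` and `C S`, where `S` selects the data points. The posterior
parameter functions do not change (`extend_postParams`), so the update applies at the larger tuple,
and its marginal at `X'` is the claim. -/

namespace SkewGP

/-! ### Normal densities and distribution functions -/

section Gaussian

variable {ι κ : Type*} [Fintype ι] [DecidableEq ι] [Fintype κ] [DecidableEq κ]

/-- A symmetric block matrix is positive definite iff its Schur complement is. -/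
theorem posDef_fromBlocks_iff (A : Matrix κ κ ℝ) (B : Matrix κ ι ℝ) {D : Matrix ι ι ℝ}
    (hD : D.PosDef) :
    (Matrix.fromBlocks A B B.transpose D).PosDef ↔ (A - B * D⁻¹ * B.transpose).PosDef := by
  have : Invertible D := hD.isUnit.invertible
  -- The semidefinite equivalence is upgraded to definiteness by the factorisation of the block
  -- determinant as `det D` times that of the Schur complement.
  have hpsd := Matrix.PosDef.fromBlocks₂₂ A B hD
  rw [Matrix.conjTranspose_eq_transpose_of_trivial] at hpsd
  have hdet := Matrix.det_fromBlocks₂₂ A B B.transpose D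
  rw [Matrix.invOf_eq_nonsing_inv] at hdet
  constructor
  · intro h
    rw [(hpsd.1 h.posSemidef).posDef_iff_det_ne_zero]
    intro h0
    exact h.det_pos.ne' (by rw [hdet, h0, mul_zero])
  · intro h
    rw [(hpsd.2 h.posSemidef).posDef_iff_det_ne_zero, hdet]
    exact mul_ne_zero hD.det_pos.ne' h.det_pos.ne'

theorem normalPDF_pos {S : Matrix ι ι ℝ} (hS : S.PosDef) (z : ι → ℝ) : 0 < normalPDF z S := by
  have := hS.det_pos
  unfold normalPDF
  positivity

theorem normalPDF_nonneg (z : ι → ℝ) (S : Matrix ι ι ℝ) : 0 ≤ normalPDF z S := by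
  unfold normalPDF
  positivity

theorem continuous_normalPDF (S : Matrix ι ι ℝ) : Continuous fun z => normalPDF z S := by
  unfold normalPDF
  fun_prop

theorem normalPDF_reindex (e : ι ≃ κ) (z : κ → ℝ) (S : Matrix κ κ ℝ) :
    normalPDF (z ∘ e) (S.submatrix e e) = normalPDF z S := by
  unfold normalPDF
  rw [Matrix.det_submatrix_equiv_self, Matrix.inv_submatrix_equiv, Fintype.card_congr e,
    Matrix.submatrix_mulVec_equiv]
  have : (z ∘ e) ∘ e.symm = z := by ext; simp
  rw [this, comp_equiv_dotProduct_comp_equiv]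

/-- The joint normal density is the product of a marginal and a conditional density. -/
theorem normalPDF_fromBlocks {A : Matrix κ κ ℝ} {B : Matrix κ ι ℝ} {D : Matrix ι ι ℝ}
    (hM : (Matrix.fromBlocks A B B.transpose D).PosDef) (hD : D.PosDef) (a : κ → ℝ) (b : ι → ℝ) :
    normalPDF (Sum.elim a b) (Matrix.fromBlocks A B B.transpose D) =
      normalPDF b D * normalPDF (a - (B * D⁻¹).mulVec b) (A - B * D⁻¹ * B.transpose) := by
  have hS := (posDef_fromBlocks_iff A B hD).1 hM
  have : Invertible D := hD.isUnit.invertible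
  have hdet := Matrix.det_fromBlocks₂₂ A B B.transpose D
  rw [Matrix.invOf_eq_nonsing_inv] at hdet
  set S := A - B * D⁻¹ * B.transpose with hSdef
  set M := Matrix.fromBlocks A B B.transpose D
  obtain ⟨c, hc⟩ : ∃ c, c = a - (B * D⁻¹).mulVec b := ⟨_, rfl⟩
  -- `(x, y)` solves `M (x, y) = (a, b)` by block elimination, which yields the quadratic form of
  -- `M⁻¹` without a formula for the blocks of `M⁻¹`.
  obtain ⟨x, hx⟩ : ∃ x, x = (S⁻¹).mulVec c := ⟨_, rfl⟩
  obtain ⟨y, hy⟩ : ∃ y, y = (D⁻¹).mulVec (b - B.transpose.mulVec x) := ⟨_, rfl⟩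
  have hDD : D * D⁻¹ = 1 := Matrix.mul_nonsing_inv _ hD.det_pos.ne'.isUnit
  have hSS : S * S⁻¹ = 1 := Matrix.mul_nonsing_inv _ hS.det_pos.ne'.isUnit
  have hMM : M⁻¹ * M = 1 := Matrix.nonsing_inv_mul _ hM.det_pos.ne'.isUnit
  have hSx : S.mulVec x = c := by rw [hx, Matrix.mulVec_mulVec, hSS, Matrix.one_mulVec]
  have hMv : M.mulVec (Sum.elim x y) = Sum.elim a b := by
    have h1 : A.mulVec x + B.mulVec y = a := by
      rw [hSdef, Matrix.sub_mulVec, hc] at hSx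
      rw [hy, Matrix.mulVec_mulVec, Matrix.mulVec_sub, Matrix.mulVec_mulVec]
      linear_combination (exp := 1) hSx
    have h2 : B.transpose.mulVec x + D.mulVec y = b := by
      rw [hy, Matrix.mulVec_mulVec, hDD, Matrix.one_mulVec]
      abel
    rw [Matrix.fromBlocks_mulVec]
    simp [h1, h2]
  have hinv : M⁻¹.mulVec (Sum.elim a b) = Sum.elim x y := by
    rw [← hMv, Matrix.mulVec_mulVec, hMM, Matrix.one_mulVec]
  have hsymm : D⁻¹.transpose = D⁻¹ := by
    have := hD.inv.isHermitian
    rwa [Matrix.IsHermitian, Matrix.conjTranspose_eq_transpose_of_trivial] at this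
  have hq : (Sum.elim a b) ⬝ᵥ M⁻¹.mulVec (Sum.elim a b) =
      b ⬝ᵥ D⁻¹.mulVec b + c ⬝ᵥ S⁻¹.mulVec c := by
    rw [hinv, sumElim_dotProduct_sumElim, ← hx, hy, Matrix.mulVec_sub, dotProduct_sub]
    have : b ⬝ᵥ D⁻¹.mulVec (B.transpose.mulVec x) = (B * D⁻¹).mulVec b ⬝ᵥ x := by
      rw [Matrix.mulVec_mulVec, Matrix.dotProduct_mulVec, ← Matrix.mulVec_transpose,
        Matrix.transpose_mul, Matrix.transpose_transpose, hsymm]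
    rw [this, hc, sub_dotProduct]
    ring
  unfold normalPDF
  rw [← hc, hq, hdet, Fintype.card_sum, pow_add]
  have e1 : ((2 * Real.pi) ^ Fintype.card κ * (2 * Real.pi) ^ Fintype.card ι * (D.det * S.det)) =
    ((2 * Real.pi) ^ Fintype.card ι * D.det) * ((2 * Real.pi) ^ Fintype.card κ * S.det) := by ring
  have := hD.det_pos
  rw [e1, Real.sqrt_mul (by positivity), mul_add, Real.exp_add, mul_inv]
  ring

theorem normalPDF_one (z : ι → ℝ) :
    normalPDF z 1 = ∏ i, ProbabilityTheory.gaussianPDFReal 0 1 (z i) := by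
  simp only [normalPDF, ProbabilityTheory.gaussianPDFReal, Finset.prod_mul_distrib,
    ← Real.exp_sum, Finset.prod_const, Matrix.det_one, mul_one, inv_one, Matrix.one_mulVec,
    NNReal.coe_one, Finset.card_univ, sub_zero]
  congr 1
  · rw [Real.sqrt_eq_rpow, Real.sqrt_eq_rpow, inv_pow, ← Real.rpow_natCast, ← Real.rpow_natCast,
      ← Real.rpow_mul (by positivity), ← Real.rpow_mul (by positivity), mul_comm (1 / 2 : ℝ)]
  · congr 1
    rw [dotProduct, Finset.mul_sum]
    exact Finset.sum_congr rfl fun i _ => by ring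

theorem lintegral_normalPDF_one : ∫⁻ z : ι → ℝ, ENNReal.ofReal (normalPDF z 1) = 1 := by
  have hint : Integrable fun z : ι → ℝ => normalPDF z 1 := by
    simp only [normalPDF_one]
    exact Integrable.fintype_prod fun _ => ProbabilityTheory.integrable_gaussianPDFReal 0 1
  rw [← ofReal_integral_eq_lintegral_ofReal hint (ae_of_all _ fun z => normalPDF_nonneg z 1)]
  simp only [normalPDF_one]
  rw [integral_fintype_prod_volume_eq_prod]
  simp [ProbabilityTheory.integral_gaussianPDFReal_eq_one]

-- Factor `S⁻¹ = Aᵀ A`. The substitution `z ↦ A z` turns the quadratic form into the standard one,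
-- and its Jacobian `|det A|` is the ratio of the normalising constants.
open scoped MatrixOrder in
theorem lintegral_normalPDF {S : Matrix ι ι ℝ} (hS : S.PosDef) :
    ∫⁻ z, ENNReal.ofReal (normalPDF z S) = 1 := by
  obtain ⟨A, hA⟩ := CStarAlgebra.nonneg_iff_eq_star_mul_self.1
    (Matrix.nonneg_iff_posSemidef.2 hS.inv.posSemidef)
  rw [Matrix.star_eq_conjTranspose, Matrix.conjTranspose_eq_transpose_of_trivial] at hA
  have hdS := hS.det_pos
  have hdet : S.det⁻¹ = A.det ^ 2 := by
    rw [← Ring.inverse_eq_inv', ← Matrix.det_nonsing_inv, hA, Matrix.det_mul,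
      Matrix.det_transpose, sq]
  have hA0 : A.det ≠ 0 := by
    intro h
    rw [h] at hdet
    have := inv_pos.2 hdS
    simp_all
  have hpdf (z : ι → ℝ) : normalPDF z S = |A.det| * normalPDF (Matrix.toLin' A z) 1 := by
    unfold normalPDF
    have h1 : S.det = (A.det ^ 2)⁻¹ := by rw [← hdet, inv_inv]
    rw [hA, h1, Real.sqrt_mul (by positivity), Real.sqrt_inv, Real.sqrt_sq_eq_abs]
    simp only [Matrix.det_one, mul_one, inv_one, Matrix.one_mulVec, Matrix.toLin'_apply, mul_inv,
      inv_inv]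
    rw [← Matrix.mulVec_mulVec, Matrix.dotProduct_mulVec z, Matrix.vecMul_transpose]
    ring
  have hcont : Continuous (Matrix.toLin' A) := LinearMap.continuous_on_pi _
  simp only [hpdf, ENNReal.ofReal_mul (abs_nonneg _)]
  have hm : Measurable fun z : ι → ℝ => ENNReal.ofReal (normalPDF z 1) :=
    (continuous_normalPDF 1).measurable.ennreal_ofReal
  have hm' : Measurable fun z => ENNReal.ofReal (normalPDF (Matrix.toLin' A z) 1) :=
    hm.comp hcont.measurable
  rw [lintegral_const_mul _ hm', ← lintegral_map hm hcont.measurable,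
    Real.map_matrix_volume_pi_eq_smul_volume_pi hA0,
    lintegral_smul_measure, lintegral_normalPDF_one, smul_eq_mul, mul_one, ← ENNReal.ofReal_mul
      (abs_nonneg _), ← abs_mul, mul_inv_cancel₀ hA0]
  simp

theorem integrable_normalPDF {S : Matrix ι ι ℝ} (hS : S.PosDef) :
    Integrable fun z => normalPDF z S := by
  refine ⟨(continuous_normalPDF S).aestronglyMeasurable, ?_⟩
  rw [hasFiniteIntegral_iff_ofReal (ae_of_all _ fun z => normalPDF_nonneg z S),
    lintegral_normalPDF hS]
  exact ENNReal.one_lt_top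

theorem ofReal_normalCDF {S : Matrix ι ι ℝ} (hS : S.PosDef) (a : ι → ℝ) :
    ENNReal.ofReal (normalCDF a S) = ∫⁻ u in Set.Iic a, ENNReal.ofReal (normalPDF u S) :=
  ofReal_integral_eq_lintegral_ofReal (integrable_normalPDF hS).integrableOn
    (ae_of_all _ fun z => normalPDF_nonneg z S)

theorem normalCDF_nonneg (a : ι → ℝ) (S : Matrix ι ι ℝ) : 0 ≤ normalCDF a S :=
  integral_nonneg fun z => normalPDF_nonneg z S

/-- The orthant below `a` contains a unit cube, and the density is positive everywhere. -/
theorem normalCDF_pos {S : Matrix ι ι ℝ} (hS : S.PosDef) (a : ι → ℝ) : 0 < normalCDF a S := by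
  rw [normalCDF, setIntegral_pos_iff_support_of_nonneg_ae
    (ae_of_all _ fun z => normalPDF_nonneg z S) (integrable_normalPDF hS).integrableOn]
  have : Function.support (fun z => normalPDF z S) = Set.univ :=
    Set.eq_univ_of_forall fun z => (normalPDF_pos hS z).ne'
  rw [this, Set.univ_inter]
  have hsub : (Set.univ.pi fun i => Set.Ioo (a i - 1) (a i)) ⊆ Set.Iic a :=
    fun z hz i => (hz i trivial).2.le
  refine lt_of_lt_of_le ?_ (measure_mono hsub)
  rw [Real.volume_pi_Ioo]
  simp

theorem measurable_normalCDF (S : Matrix ι ι ℝ) : Measurable fun a => normalCDF a S := by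
  have h (a : ι → ℝ) : normalCDF a S =
      ∫ u, Set.indicator {p : (ι → ℝ) × (ι → ℝ) | p.2 ≤ p.1} (fun p => normalPDF p.2 S) (a, u) := by
    rw [normalCDF, ← integral_indicator measurableSet_Iic]
    rfl
  simp only [h]
  refine (StronglyMeasurable.integral_prod_right ?_).measurable
  refine StronglyMeasurable.indicator
    ((continuous_normalPDF S).comp continuous_snd).stronglyMeasurable ?_
  exact (isClosed_le continuous_snd continuous_fst).measurableSet

/-- The normal distribution function of a block diagonal covariance is a product. -/
theorem normalCDF_blockDiag {A : Matrix κ κ ℝ} {D : Matrix ι ι ℝ} (hA : A.PosDef) (hD : D.PosDef)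
    (a : κ → ℝ) (b : ι → ℝ) :
    normalCDF (Sum.elim a b) (Matrix.fromBlocks A 0 0 D) = normalCDF a A * normalCDF b D := by
  have hM : (Matrix.fromBlocks A 0 (0 : Matrix κ ι ℝ).transpose D).PosDef := by
    rw [posDef_fromBlocks_iff _ _ hD]; simpa using hA
  have hpdf (u : κ → ℝ) (v : ι → ℝ) : normalPDF (Sum.elim u v) (Matrix.fromBlocks A 0 0 D) =
      normalPDF u A * normalPDF v D := by
    have := normalPDF_fromBlocks hM hD u v
    simpa [mul_comm] using this
  unfold normalCDF
  have hmp := volume_measurePreserving_sumPiEquivProdPi_symm fun _ : κ ⊕ ι => ℝ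
  rw [← setIntegral_prod_mul, ← Measure.volume_eq_prod,
    ← hmp.setIntegral_preimage_emb (MeasurableEquiv.measurableEmbedding _)]
  have hset : (MeasurableEquiv.sumPiEquivProdPi fun _ : κ ⊕ ι => ℝ).symm ⁻¹'
      Set.Iic (Sum.elim a b) = Set.Iic a ×ˢ Set.Iic b := by
    ext p
    simp only [Set.mem_preimage, Set.mem_Iic, Set.mem_prod, Pi.le_def, Sum.forall]
    rfl
  rw [hset]
  refine setIntegral_congr_fun (measurableSet_Iic.prod measurableSet_Iic) fun p _ => ?_
  rw [← hpdf]
  congr 1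

end Gaussian

/-- A density that factors through `g` survives the pushforward along `g`. This serves both
permutations of coordinates and the evaluation of the process at the data points. -/
theorem map_withDensity_comp {α β : Type*} [MeasurableSpace α] [MeasurableSpace β]
    {μ : Measure α} {ν : Measure β} {g : α → β} (hg : MeasurePreserving g μ ν)
    {f : β → ENNReal} (hf : Measurable f) :
    (μ.withDensity fun a => f (g a)).map g = ν.withDensity f := by
  ext s hs
  rw [Measure.map_apply hg.measurable hs, withDensity_apply _ (hg.measurable hs),
    withDensity_apply _ hs, hg.setLIntegral_comp_preimage hs hf]

/-! ### Unified skew-normal laws as conditioned normal laws -/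

section Latent

variable {ι κ : Type*} [Fintype ι] [DecidableEq ι] [Fintype κ] [DecidableEq κ]

/-- The centred normal distribution, as the measure with density `normalPDF`. -/
noncomputable def gaussian (S : Matrix ι ι ℝ) : Measure (ι → ℝ) :=
  volume.withDensity fun z => ENNReal.ofReal (normalPDF z S)

theorem measurable_ofReal_normalPDF (S : Matrix ι ι ℝ) :
    Measurable fun z => ENNReal.ofReal (normalPDF z S) :=
  (continuous_normalPDF S).measurable.ennreal_ofReal

theorem gaussian_map_equiv (e : ι ≃ κ) (S : Matrix κ κ ℝ) :
    (gaussian S).map (fun z i => z (e i)) = gaussian (S.submatrix e e) := by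
  have hmp := (volume_measurePreserving_piCongrLeft (fun _ : κ => ℝ) e).symm
  have key := map_withDensity_comp hmp (measurable_ofReal_normalPDF (S.submatrix e e))
  have h (z : κ → ℝ) : (MeasurableEquiv.piCongrLeft (fun _ : κ => ℝ) e).symm z = z ∘ e := by
    ext i; rfl
  simp only [h, normalPDF_reindex] at key
  exact key

/-- Normal densities integrate over a product of sets as marginal times conditional. -/
theorem gaussian_fromBlocks_apply {A : Matrix κ κ ℝ} {B : Matrix κ ι ℝ} {D : Matrix ι ι ℝ}
    (hM : (Matrix.fromBlocks A B B.transpose D).PosDef) (hD : D.PosDef)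
    {s : Set (κ → ℝ)} {t : Set (ι → ℝ)} (hs : MeasurableSet s) (ht : MeasurableSet t) :
    gaussian (Matrix.fromBlocks A B B.transpose D)
        {w | (fun k => w (Sum.inl k)) ∈ s ∧ (fun i => w (Sum.inr i)) ∈ t} =
      ∫⁻ b in t, ENNReal.ofReal (normalPDF b D) * ∫⁻ a in s,
        ENNReal.ofReal (normalPDF (a - (B * D⁻¹).mulVec b) (A - B * D⁻¹ * B.transpose)) := by
  have hmeas : MeasurableSet
      {w : κ ⊕ ι → ℝ | (fun k => w (Sum.inl k)) ∈ s ∧ (fun i => w (Sum.inr i)) ∈ t} :=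
    (measurable_pi_lambda _ fun k => measurable_pi_apply _) hs |>.inter
      ((measurable_pi_lambda _ fun k => measurable_pi_apply _) ht)
  have hmp := volume_measurePreserving_sumPiEquivProdPi_symm fun _ : κ ⊕ ι => ℝ
  rw [gaussian, withDensity_apply _ hmeas,
    ← hmp.setLIntegral_comp_preimage hmeas (measurable_ofReal_normalPDF _)]
  have hset : (MeasurableEquiv.sumPiEquivProdPi fun _ : κ ⊕ ι => ℝ).symm ⁻¹'
      {w | (fun k => w (Sum.inl k)) ∈ s ∧ (fun i => w (Sum.inr i)) ∈ t} = s ×ˢ t := by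
    ext p
    rfl
  have hpt (p : (κ → ℝ) × (ι → ℝ)) :
      (MeasurableEquiv.sumPiEquivProdPi fun _ : κ ⊕ ι => ℝ).symm p = Sum.elim p.1 p.2 := by
    ext (i | i) <;> rfl
  simp only [hset, hpt, normalPDF_fromBlocks hM hD, ENNReal.ofReal_mul (normalPDF_nonneg _ _)]
  have hcond : Measurable fun p : (κ → ℝ) × (ι → ℝ) => ENNReal.ofReal
      (normalPDF (p.1 - (B * D⁻¹).mulVec p.2) (A - B * D⁻¹ * B.transpose)) :=
    (measurable_ofReal_normalPDF _).comp (by fun_prop)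
  rw [Measure.volume_eq_prod, ← Measure.prod_restrict, lintegral_prod_symm]
  · refine lintegral_congr fun b => ?_
    have hb : Measurable fun a : κ → ℝ => ENNReal.ofReal
        (normalPDF (a - (B * D⁻¹).mulVec b) (A - B * D⁻¹ * B.transpose)) :=
      (measurable_ofReal_normalPDF _).comp (measurable_id.sub_const _)
    exact lintegral_const_mul (μ := (volume : Measure (κ → ℝ)).restrict s)
      (ENNReal.ofReal (normalPDF b D)) hb
  · exact (((measurable_ofReal_normalPDF D).comp measurable_snd).mul hcond).aemeasurable

/-- For each `b` the conditional density is a translate of a centred normal density, so it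
integrates to one. -/
theorem gaussian_map_inr {A : Matrix κ κ ℝ} {B : Matrix κ ι ℝ} {D : Matrix ι ι ℝ}
    (hM : (Matrix.fromBlocks A B B.transpose D).PosDef) :
    (gaussian (Matrix.fromBlocks A B B.transpose D)).map (fun w i => w (Sum.inr i)) =
      gaussian D := by
  have hD : D.PosDef := hM.submatrix Sum.inr_injective
  ext t ht
  have h := gaussian_fromBlocks_apply hM hD MeasurableSet.univ ht
  rw [Measure.map_apply (by fun_prop) ht]
  simp only [Set.mem_univ, true_and, Measure.restrict_univ] at h
  rw [Set.preimage, h, gaussian, withDensity_apply _ ht]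
  refine lintegral_congr fun b => ?_
  rw [lintegral_sub_right_eq_self
    (fun a => ENNReal.ofReal (normalPDF a (A - B * D⁻¹ * B.transpose))),
    lintegral_normalPDF ((posDef_fromBlocks_iff A B hD).1 hM), mul_one]

/-- Marginals of a normal distribution. -/
theorem gaussian_map_injective {e : ι → κ} (he : Function.Injective e) {S : Matrix κ κ ℝ}
    (hS : S.PosDef) : (gaussian S).map (fun z i => z (e i)) = gaussian (S.submatrix e e) := by
  classical
  -- Reorder the coordinates so that the selected ones form the second block; the marginal on that
  -- block is already known.
  let σ : {k // k ∉ Set.range e} ⊕ ι ≃ κ :=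
    (Equiv.sumComm _ _).trans
      (((Equiv.ofInjective e he).sumCongr (Equiv.refl _)).trans (Equiv.Set.sumCompl (Set.range e)))
  have hσ (i : ι) : σ (Sum.inr i) = e i := by
    simp only [σ, Equiv.trans_apply, Equiv.sumComm_apply, Sum.swap_inr, Equiv.sumCongr_apply,
      Sum.map_inl, Equiv.ofInjective_apply]
    exact Equiv.Set.sumCompl_apply_inl _ _
  set M := S.submatrix σ σ with hMdef
  have hM : M.PosDef := hS.submatrix σ.injective
  have hsymm : M.toBlocks₂₁ = M.toBlocks₁₂.transpose := by
    ext i j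
    have := hM.isHermitian.apply (Sum.inr i) (Sum.inl j)
    exact this.symm
  have hblocks : M = Matrix.fromBlocks M.toBlocks₁₁ M.toBlocks₁₂ M.toBlocks₁₂.transpose
      M.toBlocks₂₂ := by
    rw [← hsymm, Matrix.fromBlocks_toBlocks]
  have hD : M.toBlocks₂₂ = S.submatrix e e := by
    ext i j
    simp [hMdef, Matrix.toBlocks₂₂, hσ]
  have h1 := gaussian_map_equiv σ S
  rw [← hMdef] at h1
  have h2 := gaussian_map_inr (hblocks ▸ hM)
  rw [← hblocks, ← h1, Measure.map_map (by fun_prop) (by fun_prop), hD] at h2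
  rw [← h2]
  congr 1

/-- The covariance of the latent vector and the observed vector (up to the sign of the former). -/
def latentCov (Γ : Matrix κ κ ℝ) (K : Matrix ι κ ℝ) (Om : Matrix ι ι ℝ) :
    Matrix (κ ⊕ ι) (κ ⊕ ι) ℝ :=
  Matrix.fromBlocks Γ (-K.transpose) (-K.transpose).transpose Om

theorem latentCov_posDef_iff {Γ : Matrix κ κ ℝ} {K : Matrix ι κ ℝ} {Om : Matrix ι ι ℝ}
    (hOm : Om.PosDef) :
    (latentCov Γ K Om).PosDef ↔ (Γ - K.transpose * Om⁻¹ * K).PosDef := by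
  rw [latentCov, posDef_fromBlocks_iff _ _ hOm]
  simp

theorem isUnit_sdDiag {S : Matrix ι ι ℝ} (hS : ∀ i, 0 < S i i) : IsUnit (sdDiag S) := by
  rw [sdDiag, Matrix.isUnit_diagonal, Pi.isUnit_iff]
  exact fun i => (Real.sqrt_pos.2 (hS i)).ne'.isUnit

omit [Fintype ι] in
theorem sdDiag_transpose (S : Matrix ι ι ℝ) : (sdDiag S).transpose = sdDiag S :=
  Matrix.diagonal_transpose _

theorem sdDiag_mul_corr_mul_sdDiag {S : Matrix ι ι ℝ} (hS : ∀ i, 0 < S i i) :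
    sdDiag S * corr S * sdDiag S = S := by
  have h := (Matrix.isUnit_iff_isUnit_det _).1 (isUnit_sdDiag hS)
  rw [corr, Matrix.mul_assoc, Matrix.mul_assoc, Matrix.nonsing_inv_mul _ h, Matrix.mul_one,
    Matrix.mul_nonsing_inv_cancel_left _ _ h]

theorem corr_inv {S : Matrix ι ι ℝ} (hS : ∀ i, 0 < S i i) :
    (corr S)⁻¹ = sdDiag S * S⁻¹ * sdDiag S := by
  have h := (Matrix.isUnit_iff_isUnit_det _).1 (isUnit_sdDiag hS)
  rw [corr, Matrix.mul_inv_rev, Matrix.mul_inv_rev, Matrix.nonsing_inv_nonsing_inv _ h,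
    Matrix.mul_assoc]

/-- A nonpositive diagonal entry has square root `0` by convention, which makes `sdDiag S` singular;
its inverse is then `0` by convention, and so is `corr S`. -/
theorem diag_pos_of_corr_posDef {S : Matrix ι ι ℝ} (hS : (corr S).PosDef) (i : ι) :
    0 < S i i := by
  by_contra h
  have h0 : ¬ IsUnit (sdDiag S) := by
    rw [sdDiag, Matrix.isUnit_diagonal, Pi.isUnit_iff]
    intro h'
    exact (h' i).ne_zero (Real.sqrt_eq_zero_of_nonpos (not_lt.1 h))
  have h1 : (sdDiag S)⁻¹ = 0 :=
    Matrix.nonsing_inv_apply_not_isUnit _ fun h' => h0 ((Matrix.isUnit_iff_isUnit_det _).2 h')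
  have h2 := hS.diag_pos (i := i)
  simp [corr, h1] at h2

/-- The admissibility condition in terms of covariances instead of correlations. -/
theorem posDef_corr_blocks_iff {Γ : Matrix κ κ ℝ} {Δ : Matrix ι κ ℝ} {Om : Matrix ι ι ℝ} :
    (Matrix.fromBlocks Γ Δ.transpose Δ (corr Om)).PosDef ↔
      (latentCov Γ (sdDiag Om * Δ) Om).PosDef := by
  have key (hpos : ∀ i, 0 < Om i i) : (Matrix.fromBlocks Γ Δ.transpose Δ (corr Om)).PosDef ↔
      (latentCov Γ (sdDiag Om * Δ) Om).PosDef := by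
    -- Conjugation by this matrix rescales correlations to covariances; the minus sign produces the
    -- sign of the off-diagonal blocks of `latentCov`.
    let U : Matrix (κ ⊕ ι) (κ ⊕ ι) ℝ := Matrix.fromBlocks 1 0 0 (-sdDiag Om)
    have hU : IsUnit U := by
      rw [Matrix.isUnit_fromBlocks_zero₂₁]
      exact ⟨isUnit_one, (isUnit_sdDiag hpos).neg⟩
    rw [← Matrix.IsUnit.posDef_star_right_conjugate_iff hU]
    simp only [U, Matrix.star_eq_conjTranspose, Matrix.conjTranspose_eq_transpose_of_trivial,
      Matrix.fromBlocks_transpose, Matrix.fromBlocks_multiply, latentCov]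
    simp [sdDiag_transpose, sdDiag_mul_corr_mul_sdDiag hpos]
  constructor
  · intro h
    exact (key (diag_pos_of_corr_posDef (h.submatrix Sum.inr_injective))).1 h
  · intro h
    exact (key fun i => h.diag_pos (i := Sum.inr i)).2 h

/-- The correlation scaling is absorbed into `D Δ`, so that all later computations involve
covariances only. -/
theorem sunPDF_eq {Om : Matrix ι ι ℝ} (hOm : Om.PosDef) (ξ : ι → ℝ) (Δ : Matrix ι κ ℝ)
    (γ : κ → ℝ) (Γ : Matrix κ κ ℝ) (z : ι → ℝ) :
    sunPDF ξ Om Δ γ Γ z = normalPDF (z - ξ) Om *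
      (normalCDF (γ + ((sdDiag Om * Δ).transpose * Om⁻¹).mulVec (z - ξ))
        (Γ - (sdDiag Om * Δ).transpose * Om⁻¹ * (sdDiag Om * Δ)) / normalCDF γ Γ) := by
  have hpos : ∀ i, 0 < Om i i := fun i => hOm.diag_pos
  have h := (Matrix.isUnit_iff_isUnit_det _).1 (isUnit_sdDiag hpos)
  have e1 : Δ.transpose * (corr Om)⁻¹ * (sdDiag Om)⁻¹ = (sdDiag Om * Δ).transpose * Om⁻¹ := by
    rw [corr_inv hpos, Matrix.transpose_mul, sdDiag_transpose]
    simp only [Matrix.mul_assoc, Matrix.mul_nonsing_inv _ h, Matrix.mul_one]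
  have e2 : Δ.transpose * (corr Om)⁻¹ * Δ =
      (sdDiag Om * Δ).transpose * Om⁻¹ * (sdDiag Om * Δ) := by
    rw [corr_inv hpos, Matrix.transpose_mul, sdDiag_transpose]
    simp only [Matrix.mul_assoc]
  rw [sunPDF, e1, e2]

/-- A unified skew-normal vector is a normal vector conditioned on the latent one. -/
theorem sun_eq_map {ξ : ι → ℝ} {Om : Matrix ι ι ℝ} {Δ : Matrix ι κ ℝ} {γ : κ → ℝ}
    {Γ : Matrix κ κ ℝ} (hM : (latentCov Γ (sdDiag Om * Δ) Om).PosDef) :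
    sun ξ Om Δ γ Γ = (ENNReal.ofReal (normalCDF γ Γ))⁻¹ •
      ((gaussian (latentCov Γ (sdDiag Om * Δ) Om)).restrict
        {w | (fun k => w (Sum.inl k)) ∈ Set.Iic γ}).map fun w i => w (Sum.inr i) + ξ i := by
  have hOm : Om.PosDef := hM.submatrix Sum.inr_injective
  have hΓ : Γ.PosDef := hM.submatrix Sum.inl_injective
  have hS := (latentCov_posDef_iff hOm).1 hM
  have hcdf := normalCDF_pos hΓ γ
  ext t ht
  have hmeas : Measurable fun (w : κ ⊕ ι → ℝ) i => w (Sum.inr i) + ξ i := by fun_prop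
  rw [Measure.smul_apply, Measure.map_apply hmeas ht, Measure.restrict_apply (hmeas ht),
    Set.inter_comm]
  have hshift := measurePreserving_add_right (volume : Measure (ι → ℝ)) ξ
  have happ := gaussian_fromBlocks_apply hM hOm (measurableSet_Iic (a := γ))
    (hshift.measurable ht)
  rw [← latentCov] at happ
  have hset : {w : κ ⊕ ι → ℝ | (fun k => w (Sum.inl k)) ∈ Set.Iic γ} ∩
      (fun (w : κ ⊕ ι → ℝ) i => w (Sum.inr i) + ξ i) ⁻¹' t =
      {w | (fun k => w (Sum.inl k)) ∈ Set.Iic γ ∧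
        (fun i => w (Sum.inr i)) ∈ (fun x => x + ξ) ⁻¹' t} := rfl
  rw [hset, happ, sun, withDensity_apply _ ht,
    ← hshift.setLIntegral_comp_preimage_emb (measurableEmbedding_addRight ξ), smul_eq_mul,
    ← lintegral_const_mul']
  swap
  · simpa using hcdf
  refine lintegral_congr fun b => ?_
  -- Given the observed part `b`, the latent vector has mean `-Kᵀ Ω⁻¹ b` with `K = D Δ`, so its
  -- probability of lying below `γ` is the distribution function at `γ + Kᵀ Ω⁻¹ b`. This is why
  -- `latentCov` carries a minus sign.
  have hcond : ∫⁻ a in Set.Iic γ, ENNReal.ofReal (normalPDF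
      (a - (-(sdDiag Om * Δ).transpose * Om⁻¹).mulVec b)
      (Γ - -(sdDiag Om * Δ).transpose * Om⁻¹ * (-(sdDiag Om * Δ).transpose).transpose)) =
      ENNReal.ofReal (normalCDF (γ + ((sdDiag Om * Δ).transpose * Om⁻¹).mulVec b)
        (Γ - (sdDiag Om * Δ).transpose * Om⁻¹ * (sdDiag Om * Δ))) := by
    rw [ofReal_normalCDF hS]
    have hshift' := measurePreserving_add_right (volume : Measure (κ → ℝ))
      (((sdDiag Om * Δ).transpose * Om⁻¹).mulVec b)
    rw [← hshift'.setLIntegral_comp_preimage_emb (measurableEmbedding_addRight _)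
      (fun u => ENNReal.ofReal (normalPDF u _))]
    simp only [Set.preimage_add_const_Iic, add_sub_cancel_right, Matrix.neg_mul,
      Matrix.neg_mulVec, sub_neg_eq_add, Matrix.transpose_neg, Matrix.transpose_transpose,
      Matrix.mul_neg, neg_neg]
  rw [hcond, sunPDF_eq hOm, add_sub_cancel_right, ENNReal.ofReal_mul (normalPDF_nonneg _ _),
    ENNReal.ofReal_div_of_pos hcdf, div_eq_mul_inv]
  ring

/-- The latent marginal is `N(0, Γ)`, so the conditioning event has probability `normalCDF γ Γ`, the
normalising constant. -/
theorem sun_isProbabilityMeasure {ξ : ι → ℝ} {Om : Matrix ι ι ℝ} {Δ : Matrix ι κ ℝ} {γ : κ → ℝ}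
    {Γ : Matrix κ κ ℝ} (hM : (latentCov Γ (sdDiag Om * Δ) Om).PosDef) :
    IsProbabilityMeasure (sun ξ Om Δ γ Γ) := by
  have hΓ : Γ.PosDef := hM.submatrix Sum.inl_injective
  have h := gaussian_map_injective (e := (Sum.inl : κ → κ ⊕ ι)) Sum.inl_injective hM
  have h' : (latentCov Γ (sdDiag Om * Δ) Om).submatrix Sum.inl Sum.inl = Γ := rfl
  rw [h'] at h
  have h2 := congrArg (fun μ => μ (Set.Iic γ)) h
  rw [Measure.map_apply (by fun_prop) measurableSet_Iic, gaussian.eq_1 Γ,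
    withDensity_apply _ measurableSet_Iic, ← ofReal_normalCDF hΓ] at h2
  constructor
  rw [sun_eq_map hM, Measure.smul_apply, Measure.map_apply (by fun_prop) MeasurableSet.univ,
    Set.preimage_univ, Measure.restrict_apply_univ, smul_eq_mul]
  rw [Set.preimage] at h2
  rw [h2]
  exact ENNReal.inv_mul_cancel (by simpa using normalCDF_pos hΓ γ) ENNReal.ofReal_ne_top

-- The standard deviations depend on diagonal entries only, so selecting points commutes with
-- forming `D Δ`.
omit [Fintype κ] [DecidableEq κ] in
theorem latentCov_submatrix {ι' : Type*} [Fintype ι'] [DecidableEq ι'] (e : ι' → ι)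
    (Γ : Matrix κ κ ℝ) (Δ : Matrix ι κ ℝ) (Om : Matrix ι ι ℝ) :
    (latentCov Γ (sdDiag Om * Δ) Om).submatrix (Sum.map id e) (Sum.map id e) =
      latentCov Γ (sdDiag (Om.submatrix e e) * Δ.submatrix e id) (Om.submatrix e e) := by
  ext (i | i) (j | j) <;> simp [latentCov, sdDiag]

/-- Marginals of a unified skew-normal distribution. -/
theorem sun_map_injective {ι' : Type*} [Fintype ι'] [DecidableEq ι'] {e : ι' → ι}
    (he : Function.Injective e) {ξ : ι → ℝ} {Om : Matrix ι ι ℝ} {Δ : Matrix ι κ ℝ} {γ : κ → ℝ}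
    {Γ : Matrix κ κ ℝ} (hM : (latentCov Γ (sdDiag Om * Δ) Om).PosDef) :
    (sun ξ Om Δ γ Γ).map (fun z i => z (e i)) =
      sun (ξ ∘ e) (Om.submatrix e e) (Δ.submatrix e id) γ Γ := by
  have he' : Function.Injective (Sum.map (id : κ → κ) e) :=
    Function.injective_id.sumMap he
  have hM' := hM.submatrix he'
  have hg := gaussian_map_injective he' hM
  rw [latentCov_submatrix] at hM' hg
  rw [sun_eq_map hM, sun_eq_map hM', Measure.map_smul, ← hg,
    Measure.map_map (by fun_prop) (by fun_prop), Measure.restrict_map (by fun_prop),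
    Measure.map_map (by fun_prop) (by fun_prop)]
  · rfl
  · exact (measurable_pi_lambda _ fun k => measurable_pi_apply _) measurableSet_Iic

end Latent

/-! ### Conditioning on noisy linear observations, and the extended latent vector -/

section Update

variable {ι κ μ ρ : Type*} [Fintype ι] [DecidableEq ι] [Fintype κ] [DecidableEq κ]
  [Fintype μ] [DecidableEq μ] [Fintype ρ] [DecidableEq ρ]

/-- The covariance of a normal vector after conditioning on noisy linear observations. -/
noncomputable def condCov (Om : Matrix ι ι ℝ) (C : Matrix ρ ι ℝ) (R : Matrix ρ ρ ℝ) :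
    Matrix ι ι ℝ :=
  Om - Om * (C.transpose * (C * Om * C.transpose + R)⁻¹ * C) * Om

omit [DecidableEq ι] [DecidableEq ρ] in
theorem posDef_observation {Om : Matrix ι ι ℝ} (hOm : Om.PosDef) (C : Matrix ρ ι ℝ)
    {R : Matrix ρ ρ ℝ} (hR : R.PosDef) : (C * Om * C.transpose + R).PosDef := by
  have := hOm.posSemidef.mul_mul_conjTranspose_same C
  rw [Matrix.conjTranspose_eq_transpose_of_trivial] at this
  exact hR.posSemidef_add this

theorem posDef_precision {Om : Matrix ι ι ℝ} (hOm : Om.PosDef) (C : Matrix ρ ι ℝ)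
    {R : Matrix ρ ρ ℝ} (hR : R.PosDef) : (Om⁻¹ + C.transpose * R⁻¹ * C).PosDef := by
  have := hR.inv.posSemidef.conjTranspose_mul_mul_same C
  rw [Matrix.conjTranspose_eq_transpose_of_trivial] at this
  exact hOm.inv.add_posSemidef this

/-- The Woodbury identity: conditioning adds the precision `Cᵀ R⁻¹ C` of the observations to the
prior precision. -/
theorem condCov_eq_inv {Om : Matrix ι ι ℝ} (hOm : Om.PosDef) (C : Matrix ρ ι ℝ)
    {R : Matrix ρ ρ ℝ} (hR : R.PosDef) :
    condCov Om C R = (Om⁻¹ + C.transpose * R⁻¹ * C)⁻¹ := by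
  have hO := (Matrix.isUnit_iff_isUnit_det _).1 hOm.isUnit
  have hR' := (Matrix.isUnit_iff_isUnit_det _).1 hR.isUnit
  have h := (posDef_observation hOm C hR).isUnit
  rw [Matrix.add_mul_mul_inv_eq_sub Om⁻¹ C.transpose R⁻¹ C hOm.inv.isUnit hR.inv.isUnit]
  · simp only [Matrix.nonsing_inv_nonsing_inv _ hO, Matrix.nonsing_inv_nonsing_inv _ hR', condCov,
      Matrix.mul_assoc, add_comm R]
  · simpa only [Matrix.nonsing_inv_nonsing_inv _ hO, Matrix.nonsing_inv_nonsing_inv _ hR',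
      add_comm R] using h

theorem condCov_posDef {Om : Matrix ι ι ℝ} (hOm : Om.PosDef) (C : Matrix ρ ι ℝ)
    {R : Matrix ρ ρ ℝ} (hR : R.PosDef) : (condCov Om C R).PosDef := by
  rw [condCov_eq_inv hOm C hR]
  exact (posDef_precision hOm C hR).inv

theorem condCov_inv {Om : Matrix ι ι ℝ} (hOm : Om.PosDef) (C : Matrix ρ ι ℝ)
    {R : Matrix ρ ρ ℝ} (hR : R.PosDef) :
    (condCov Om C R)⁻¹ = Om⁻¹ + C.transpose * R⁻¹ * C := by
  rw [condCov_eq_inv hOm C hR, Matrix.nonsing_inv_nonsing_inv _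
    ((Matrix.isUnit_iff_isUnit_det _).1 (posDef_precision hOm C hR).isUnit)]

/-- This identifies the shift of the mean as the solution of the normal equations, which is what
cancels the linear terms when the square is completed. -/
theorem precision_mul_gain {Om : Matrix ι ι ℝ} (hOm : Om.PosDef) (C : Matrix ρ ι ℝ)
    {R : Matrix ρ ρ ℝ} (hR : R.PosDef) :
    (Om⁻¹ + C.transpose * R⁻¹ * C) *
      (Om * (C.transpose * (C * Om * C.transpose + R)⁻¹)) = C.transpose * R⁻¹ := by
  have hO := (Matrix.isUnit_iff_isUnit_det _).1 hOm.isUnit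
  have hR' := (Matrix.isUnit_iff_isUnit_det _).1 hR.isUnit
  have h := (Matrix.isUnit_iff_isUnit_det _).1 (posDef_observation hOm C hR).isUnit
  set G := (C * Om * C.transpose + R)⁻¹ with hG
  have h1 : (C * Om * C.transpose + R) * G = 1 := Matrix.mul_nonsing_inv _ h
  calc _ = Om⁻¹ * Om * (C.transpose * G) + C.transpose * R⁻¹ * (C * Om * C.transpose) * G := by
        simp only [Matrix.add_mul, Matrix.mul_assoc]
    _ = C.transpose * (R⁻¹ * R) * G + C.transpose * R⁻¹ * (C * Om * C.transpose) * G := by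
        rw [Matrix.nonsing_inv_mul _ hO, Matrix.nonsing_inv_mul _ hR', Matrix.one_mul,
          Matrix.mul_one]
    _ = C.transpose * R⁻¹ * ((C * Om * C.transpose + R) * G) := by
        simp only [Matrix.add_mul, Matrix.mul_add, Matrix.mul_assoc, add_comm]
    _ = _ := by rw [h1, Matrix.mul_one]

omit [DecidableEq ι] in
theorem isSymm_dotProduct_mulVec {S : Matrix ι ι ℝ} (hS : S.transpose = S) (x y : ι → ℝ) :
    x ⬝ᵥ S.mulVec y = y ⬝ᵥ S.mulVec x := by
  rw [Matrix.dotProduct_mulVec, ← Matrix.mulVec_transpose, hS, dotProduct_comm]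

omit [Fintype ι] [DecidableEq ι] in
theorem transpose_eq_of_posDef {S : Matrix ι ι ℝ} (hS : S.PosDef) : S.transpose = S := by
  have := hS.isHermitian
  rwa [Matrix.IsHermitian, Matrix.conjTranspose_eq_transpose_of_trivial] at this

/-- Conjugacy of normal densities, up to a factor which does not depend on the vector. -/
theorem exists_normalPDF_mul_normalPDF {Om : Matrix ι ι ℝ} (hOm : Om.PosDef) (C : Matrix ρ ι ℝ)
    {R : Matrix ρ ρ ℝ} (hR : R.PosDef) (r : ρ → ℝ) :
    ∃ c : ℝ, 0 < c ∧ ∀ w, normalPDF w Om * normalPDF (r - C.mulVec w) R =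
      c * normalPDF (w - (Om * (C.transpose * (C * Om * C.transpose + R)⁻¹)).mulVec r)
        (condCov Om C R) := by
  obtain ⟨δ, hδ⟩ : ∃ δ,
    δ = (Om * (C.transpose * (C * Om * C.transpose + R)⁻¹)).mulVec r := ⟨_, rfl⟩
  rw [← hδ]
  have hinv := condCov_inv hOm C hR
  have hdet := (condCov_posDef hOm C hR).det_pos
  have hdO := hOm.det_pos
  have hdR := hR.det_pos
  set Q := Om⁻¹ + C.transpose * R⁻¹ * C with hQ
  have hQδ : Q.mulVec δ = (C.transpose * R⁻¹).mulVec r := by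
    rw [hδ, Matrix.mulVec_mulVec, precision_mul_gain hOm C hR]
  have hQs := transpose_eq_of_posDef (posDef_precision hOm C hR)
  have hRs := transpose_eq_of_posDef hR.inv
  rw [← hQ] at hQs
  have hquad (w : ι → ℝ) : w ⬝ᵥ Om⁻¹.mulVec w + (r - C.mulVec w) ⬝ᵥ R⁻¹.mulVec (r - C.mulVec w) =
      (w - δ) ⬝ᵥ Q.mulVec (w - δ) + (r ⬝ᵥ R⁻¹.mulVec r - δ ⬝ᵥ Q.mulVec δ) := by
    have h1 : w ⬝ᵥ Q.mulVec w = w ⬝ᵥ Om⁻¹.mulVec w + C.mulVec w ⬝ᵥ R⁻¹.mulVec (C.mulVec w) := by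
      rw [hQ, Matrix.add_mulVec, dotProduct_add, ← Matrix.mulVec_mulVec, ← Matrix.mulVec_mulVec,
        Matrix.dotProduct_mulVec w C.transpose, Matrix.vecMul_transpose]
    have h2 : w ⬝ᵥ Q.mulVec δ = C.mulVec w ⬝ᵥ R⁻¹.mulVec r := by
      rw [hQδ, ← Matrix.mulVec_mulVec, Matrix.dotProduct_mulVec w C.transpose,
        Matrix.vecMul_transpose]
    have h3 := isSymm_dotProduct_mulVec hQs δ w
    have h4 := isSymm_dotProduct_mulVec hRs r (C.mulVec w)
    simp only [Matrix.mulVec_sub, sub_dotProduct, dotProduct_sub]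
    rw [h3, h4, h1, h2]
    ring
  -- The ratio of the normalising constants, times the exponential of what remains after completing
  -- the square.
  refine ⟨(Real.sqrt ((2 * Real.pi) ^ Fintype.card ι * Om.det))⁻¹ *
    (Real.sqrt ((2 * Real.pi) ^ Fintype.card ρ * R.det))⁻¹ *
    Real.sqrt ((2 * Real.pi) ^ Fintype.card ι * (condCov Om C R).det) *
    Real.exp (-(1 / 2) * (r ⬝ᵥ R⁻¹.mulVec r - δ ⬝ᵥ Q.mulVec δ)), by positivity, fun w => ?_⟩
  have hs : Real.sqrt ((2 * Real.pi) ^ Fintype.card ι * (condCov Om C R).det) ≠ 0 := by positivity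
  have hexp : Real.exp (-(1 / 2) * (w ⬝ᵥ Om⁻¹.mulVec w)) *
      Real.exp (-(1 / 2) * ((r - C.mulVec w) ⬝ᵥ R⁻¹.mulVec (r - C.mulVec w))) =
      Real.exp (-(1 / 2) * (r ⬝ᵥ R⁻¹.mulVec r - δ ⬝ᵥ Q.mulVec δ)) *
        Real.exp (-(1 / 2) * ((w - δ) ⬝ᵥ Q.mulVec (w - δ))) := by
    rw [← Real.exp_add, ← Real.exp_add, ← mul_add, hquad]
    congr 1
    ring
  unfold normalPDF
  rw [hinv]
  generalize Real.sqrt ((2 * Real.pi) ^ Fintype.card ι * (condCov Om C R).det) = N at hs ⊢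
  generalize (Real.sqrt ((2 * Real.pi) ^ Fintype.card ι * Om.det))⁻¹ = a
  generalize (Real.sqrt ((2 * Real.pi) ^ Fintype.card ρ * R.det))⁻¹ = b
  linear_combination a * b * hexp - a * b *
    Real.exp (-(1 / 2) * (r ⬝ᵥ R⁻¹.mulVec r - δ ⬝ᵥ Q.mulVec δ)) *
    Real.exp (-(1 / 2) * ((w - δ) ⬝ᵥ Q.mulVec (w - δ))) * mul_inv_cancel₀ hs

/-- The cross-covariance of the observed vector with the extended latent vector. -/
def affCov (K : Matrix ι κ ℝ) (Om : Matrix ι ι ℝ) (W : Matrix μ ι ℝ) : Matrix ι (κ ⊕ μ) ℝ :=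
  Matrix.fromCols K (Om * W.transpose)

/-- The covariance of the extended latent vector. -/
def affLatentCov (Γ : Matrix κ κ ℝ) (K : Matrix ι κ ℝ) (Om : Matrix ι ι ℝ) (W : Matrix μ ι ℝ)
    (Sg : Matrix μ μ ℝ) : Matrix (κ ⊕ μ) (κ ⊕ μ) ℝ :=
  Matrix.fromBlocks Γ (K.transpose * W.transpose) (W * K) (W * Om * W.transpose + Sg)

-- Once the observed vector is fixed, the new latent coordinates retain only the probit noise, which
-- is independent of the old ones; hence the zero off-diagonal blocks.
omit [Fintype κ] [DecidableEq κ] [Fintype μ] [DecidableEq μ] in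
theorem affLatentCov_schur (Γ : Matrix κ κ ℝ) (K : Matrix ι κ ℝ) {Om : Matrix ι ι ℝ}
    (hOm : Om.PosDef) (W : Matrix μ ι ℝ) (Sg : Matrix μ μ ℝ) :
    affLatentCov Γ K Om W Sg - (affCov K Om W).transpose * Om⁻¹ * affCov K Om W =
      Matrix.fromBlocks (Γ - K.transpose * Om⁻¹ * K) 0 0 Sg := by
  have hO := (Matrix.isUnit_iff_isUnit_det _).1 hOm.isUnit
  have hs := transpose_eq_of_posDef hOm
  rw [affLatentCov, affCov, Matrix.transpose_fromCols, Matrix.fromRows_mul,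
    Matrix.fromRows_mul_fromCols, Matrix.transpose_mul, Matrix.transpose_transpose, hs]
  ext (i | i) (j | j) <;>
    simp [Matrix.mul_assoc, Matrix.nonsing_inv_mul_cancel_left _ _ hO,
      Matrix.mul_nonsing_inv_cancel_left _ _ hO]

theorem posDef_blockDiag {A : Matrix κ κ ℝ} {D : Matrix ι ι ℝ} (hA : A.PosDef) (hD : D.PosDef) :
    (Matrix.fromBlocks A 0 0 D).PosDef := by
  have := (posDef_fromBlocks_iff A (0 : Matrix κ ι ℝ) hD).2 (by simpa using hA)
  simpa using this

end Update

/-! ### Bayes' rule for measures with densities -/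

section Bayes

/-- A likelihood depending on `F` alone can be applied before or after passing to the law of `F`,
which reduces the process to a finite-dimensional problem. -/
theorem posterior_map {T α : Type*} [MeasurableSpace T] [MeasurableSpace α] (P : Measure T)
    {F : T → α} (hF : Measurable F) {ℓ : α → ℝ} (hℓ : Measurable ℓ) :
    (posterior P fun t => ℓ (F t)).map F = posterior (P.map F) ℓ := by
  have h := map_withDensity_comp (hF.measurePreserving P) hℓ.ennreal_ofReal
  rw [posterior, posterior, Measure.map_smul, h, lintegral_map hℓ.ennreal_ofReal hF]

/-- A measure whose density is proportional to that of a probability measure is normalised to the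
latter. -/
theorem posterior_withDensity {α : Type*} [MeasurableSpace α] {ν : Measure α} {p q ℓ : α → ℝ}
    (hp : Measurable p) (hq : Measurable q) (hℓ : Measurable ℓ) (hp0 : ∀ a, 0 ≤ p a) {c : ℝ}
    (hc : 0 < c) (h : ∀ a, p a * ℓ a = c * q a)
    [hprob : IsProbabilityMeasure (ν.withDensity fun a => ENNReal.ofReal (q a))] :
    posterior (ν.withDensity fun a => ENNReal.ofReal (p a)) ℓ =
      ν.withDensity fun a => ENNReal.ofReal (q a) := by
  have hmul : (fun a => ENNReal.ofReal (p a)) * (fun a => ENNReal.ofReal (ℓ a)) =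
      ENNReal.ofReal c • fun a => ENNReal.ofReal (q a) := by
    ext a
    simp only [Pi.mul_apply, Pi.smul_apply, smul_eq_mul]
    rw [← ENNReal.ofReal_mul (hp0 a), h, ENNReal.ofReal_mul hc.le]
  have hw : (ν.withDensity fun a => ENNReal.ofReal (p a)).withDensity
      (fun a => ENNReal.ofReal (ℓ a)) =
      ENNReal.ofReal c • ν.withDensity fun a => ENNReal.ofReal (q a) := by
    rw [← withDensity_mul _ hp.ennreal_ofReal hℓ.ennreal_ofReal, hmul,
      withDensity_smul _ hq.ennreal_ofReal]
  -- The evidence equals `c` because `q` has total mass one.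
  have hmass : ∫⁻ t, ENNReal.ofReal (ℓ t) ∂(ν.withDensity fun a => ENNReal.ofReal (p a)) =
      ENNReal.ofReal c := by
    rw [← setLIntegral_univ, ← withDensity_apply _ MeasurableSet.univ, hw, Measure.smul_apply,
      measure_univ, smul_eq_mul, mul_one]
  rw [posterior, hmass, hw, smul_smul, ENNReal.inv_mul_cancel (by simpa using hc)
    ENNReal.ofReal_ne_top, one_smul]

end Bayes

/-! ### The update of a unified skew-normal law -/

section SunUpdate

variable {ι κ μ ρ : Type*} [Fintype ι] [DecidableEq ι] [Fintype κ] [DecidableEq κ]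
  [Fintype μ] [DecidableEq μ] [Fintype ρ] [DecidableEq ρ]

theorem measurable_sunPDF (ξ : ι → ℝ) (Om : Matrix ι ι ℝ) (Δ : Matrix ι κ ℝ) (γ : κ → ℝ)
    (Γ : Matrix κ κ ℝ) : Measurable (sunPDF ξ Om Δ γ Γ) := by
  unfold sunPDF
  refine ((continuous_normalPDF Om).measurable.comp (by fun_prop)).mul
    (((measurable_normalCDF _).comp ?_).div_const _)
  exact Continuous.measurable (by fun_prop)

/-- The update of the parameters of a unified skew-normal prior, in terms of covariances. -/
structure IsSunUpdate (ξ : ι → ℝ) (Om : Matrix ι ι ℝ) (Δ : Matrix ι κ ℝ) (γ : κ → ℝ)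
    (Γ : Matrix κ κ ℝ) (W : Matrix μ ι ℝ) (Z : μ → ℝ) (Sg : Matrix μ μ ℝ) (C : Matrix ρ ι ℝ)
    (Y : ρ → ℝ) (R : Matrix ρ ρ ℝ) (ξ' : ι → ℝ) (Om' : Matrix ι ι ℝ) (Δ' : Matrix ι (κ ⊕ μ) ℝ)
    (γ' : κ ⊕ μ → ℝ) (Γ' : Matrix (κ ⊕ μ) (κ ⊕ μ) ℝ) : Prop where
  loc : ξ' = ξ + (Om * (C.transpose * (C * Om * C.transpose + R)⁻¹)).mulVec (Y - C.mulVec ξ)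
  scale : Om' = condCov Om C R
  skew : sdDiag Om' * Δ' = Om' * Om⁻¹ * affCov (sdDiag Om * Δ) Om W
  gamma : γ' = Sum.elim γ (Z + W.mulVec ξ) +
    ((affCov (sdDiag Om * Δ) Om W).transpose * Om⁻¹).mulVec (ξ' - ξ)
  Gamma : Γ' = affLatentCov Γ (sdDiag Om * Δ) Om W Sg -
    (affCov (sdDiag Om * Δ) Om W).transpose * Om⁻¹ * affCov (sdDiag Om * Δ) Om W +
    (affCov (sdDiag Om * Δ) Om W).transpose * Om⁻¹ * Om' * Om⁻¹ * affCov (sdDiag Om * Δ) Om W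

namespace IsSunUpdate

variable {ξ : ι → ℝ} {Om : Matrix ι ι ℝ} {Δ : Matrix ι κ ℝ} {γ : κ → ℝ}
  {Γ : Matrix κ κ ℝ} {W : Matrix μ ι ℝ} {Z : μ → ℝ} {Sg : Matrix μ μ ℝ} {C : Matrix ρ ι ℝ}
  {Y : ρ → ℝ} {R : Matrix ρ ρ ℝ} {ξ' : ι → ℝ} {Om' : Matrix ι ι ℝ} {Δ' : Matrix ι (κ ⊕ μ) ℝ}
  {γ' : κ ⊕ μ → ℝ} {Γ' : Matrix (κ ⊕ μ) (κ ⊕ μ) ℝ}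

-- The regression of the latent vector on the observed one is unaffected by further observations of
-- the latter: in `Δ'` the factor `Om'` cancels against its inverse.
omit [Fintype κ] [DecidableEq κ] [Fintype μ] [DecidableEq μ] in
theorem regression (h : IsSunUpdate ξ Om Δ γ Γ W Z Sg C Y R ξ' Om' Δ' γ' Γ') (hOm : Om.PosDef)
    (hR : R.PosDef) :
    (sdDiag Om' * Δ').transpose * Om'⁻¹ = (affCov (sdDiag Om * Δ) Om W).transpose * Om⁻¹ := by
  have hOm' : Om'.PosDef := h.scale ▸ condCov_posDef hOm C hR
  have hO' := (Matrix.isUnit_iff_isUnit_det _).1 hOm'.isUnit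
  rw [h.skew, Matrix.transpose_mul, Matrix.transpose_mul, transpose_eq_of_posDef hOm',
    transpose_eq_of_posDef hOm.inv, Matrix.mul_assoc, Matrix.mul_assoc, Matrix.mul_nonsing_inv _ hO',
    Matrix.mul_one]

-- The last summand of `Γ'` is exactly the covariance explained by the updated observed vector, so
-- the residual covariance stays that of the prior extended latent vector.
omit [Fintype κ] [DecidableEq κ] [Fintype μ] [DecidableEq μ] in
theorem schur (h : IsSunUpdate ξ Om Δ γ Γ W Z Sg C Y R ξ' Om' Δ' γ' Γ') (hOm : Om.PosDef)
    (hR : R.PosDef) :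
    Γ' - (sdDiag Om' * Δ').transpose * Om'⁻¹ * (sdDiag Om' * Δ') =
      Matrix.fromBlocks (Γ - (sdDiag Om * Δ).transpose * Om⁻¹ * (sdDiag Om * Δ)) 0 0 Sg := by
  rw [h.regression hOm hR, h.skew, h.Gamma, ← affLatentCov_schur _ _ hOm W]
  simp only [Matrix.mul_assoc, add_sub_cancel_right]

theorem posDef (h : IsSunUpdate ξ Om Δ γ Γ W Z Sg C Y R ξ' Om' Δ' γ' Γ')
    (hM : (latentCov Γ (sdDiag Om * Δ) Om).PosDef) (hSg : Sg.PosDef) (hR : R.PosDef) :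
    (latentCov Γ' (sdDiag Om' * Δ') Om').PosDef := by
  have hOm : Om.PosDef := hM.submatrix Sum.inr_injective
  have hOm' : Om'.PosDef := h.scale ▸ condCov_posDef hOm C hR
  rw [latentCov_posDef_iff hOm', h.schur hOm hR]
  exact posDef_blockDiag ((latentCov_posDef_iff hOm).1 hM) hSg

/-- Bayes' rule for a unified skew-normal prior and a mixed likelihood. -/
theorem posterior_sun (h : IsSunUpdate ξ Om Δ γ Γ W Z Sg C Y R ξ' Om' Δ' γ' Γ')
    (hM : (latentCov Γ (sdDiag Om * Δ) Om).PosDef) (hSg : Sg.PosDef) (hR : R.PosDef) :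
    posterior (sun ξ Om Δ γ Γ)
      (fun v => normalCDF (Z + W.mulVec v) Sg * normalPDF (Y - C.mulVec v) R) =
        sun ξ' Om' Δ' γ' Γ' := by
  have hOm : Om.PosDef := hM.submatrix Sum.inr_injective
  have hO := (Matrix.isUnit_iff_isUnit_det _).1 hOm.isUnit
  have hΓ : Γ.PosDef := hM.submatrix Sum.inl_injective
  have hM' := h.posDef hM hSg hR
  have hOm' : Om'.PosDef := hM'.submatrix Sum.inr_injective
  have hΓ' : Γ'.PosDef := hM'.submatrix Sum.inl_injective
  have hS := (latentCov_posDef_iff hOm).1 hM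
  have hpos := normalCDF_pos hΓ γ
  have hpos' := normalCDF_pos hΓ' γ'
  obtain ⟨c, hc, hcw⟩ := exists_normalPDF_mul_normalPDF hOm C hR (Y - C.mulVec ξ)
  have hprob : IsProbabilityMeasure (sun ξ' Om' Δ' γ' Γ') := sun_isProbabilityMeasure hM'
  -- `c` comes from the conjugacy of the normal factors; the quotient exchanges the normalisers of
  -- the two skew-normal densities.
  refine posterior_withDensity (measurable_sunPDF _ _ _ _ _) (measurable_sunPDF _ _ _ _ _) ?_ ?_
    (c := c * normalCDF γ' Γ' / normalCDF γ Γ) (by positivity) ?_ (hprob := hprob)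
  · exact ((measurable_normalCDF _).comp (Continuous.measurable (by fun_prop))).mul
      ((continuous_normalPDF _).measurable.comp (Continuous.measurable (by fun_prop)))
  · intro v
    rw [sunPDF]
    exact mul_nonneg (normalPDF_nonneg _ _)
      (div_nonneg (normalCDF_nonneg _ _) (normalCDF_nonneg _ _))
  · intro v
    have hnormal := hcw (v - ξ)
    have e1 : Y - C.mulVec ξ - C.mulVec (v - ξ) = Y - C.mulVec v := by
      rw [Matrix.mulVec_sub]; abel
    have e2 : v - ξ - (ξ' - ξ) = v - ξ' := by abel
    have e3 : (Om * (C.transpose * (C * Om * C.transpose + R)⁻¹)).mulVec (Y - C.mulVec ξ) =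
        ξ' - ξ := by
      rw [h.loc]; abel
    rw [e1, e3, e2, ← h.scale] at hnormal
    -- The argument on the left is affine in `v` with unchanged slope, and the shift in `γ'` moves
    -- its centre from `ξ'` back to `ξ`. Its second block is then `Z + W v`, and the block diagonal
    -- covariance splits the distribution function.
    have hcdf : normalCDF (γ' + ((sdDiag Om' * Δ').transpose * Om'⁻¹).mulVec (v - ξ'))
        (Γ' - (sdDiag Om' * Δ').transpose * Om'⁻¹ * (sdDiag Om' * Δ')) =
        normalCDF (γ + ((sdDiag Om * Δ).transpose * Om⁻¹).mulVec (v - ξ))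
          (Γ - (sdDiag Om * Δ).transpose * Om⁻¹ * (sdDiag Om * Δ)) *
          normalCDF (Z + W.mulVec v) Sg := by
      rw [h.schur hOm hR, ← normalCDF_blockDiag hS hSg]
      congr 1
      rw [h.regression hOm hR, h.gamma, add_assoc, ← Matrix.mulVec_add, add_comm (ξ' - ξ),
        sub_add_sub_cancel, affCov, Matrix.transpose_fromCols, Matrix.fromRows_mul,
        Matrix.fromRows_mulVec, Matrix.transpose_mul Om, Matrix.transpose_transpose,
        transpose_eq_of_posDef hOm, Matrix.mul_assoc W, Matrix.mul_nonsing_inv _ hO, Matrix.mul_one,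
        ← Sum.elim_add_add, Matrix.mulVec_sub W]
      congr 1
      abel
    rw [sunPDF_eq hOm, sunPDF_eq hOm', hcdf]
    field_simp
    linear_combination (normalCDF (γ + ((sdDiag Om * Δ).transpose * Om⁻¹).mulVec (v - ξ))
          (Γ - (sdDiag Om * Δ).transpose * Om⁻¹ * (sdDiag Om * Δ)) *
          normalCDF (Z + W.mulVec v) Sg) * hnormal

end IsSunUpdate

end SunUpdate

/-! ### Selection matrices -/

section Selection

variable {m n : ℕ}

/-- The matrix which selects the coordinates in the range of `e`. -/
def selection (e : Fin n → Fin m) : Matrix (Fin n) (Fin m) ℝ :=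
  (1 : Matrix (Fin m) (Fin m) ℝ).submatrix e id

theorem selection_mul {α : Type*} (e : Fin n → Fin m) (M : Matrix (Fin m) α ℝ) :
    selection e * M = M.submatrix e id := by
  ext i j
  simp [selection, Matrix.mul_apply, Matrix.one_apply]

theorem mul_selection_transpose {α : Type*} (e : Fin n → Fin m) (M : Matrix α (Fin m) ℝ) :
    M * (selection e).transpose = M.submatrix id e := by
  ext i j
  simp [selection, Matrix.mul_apply, Matrix.one_apply]

theorem selection_mulVec (e : Fin n → Fin m) (v : Fin m → ℝ) :
    (selection e).mulVec v = v ∘ e := by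
  ext i
  simp [selection, Matrix.mulVec, dotProduct, Matrix.one_apply]

theorem vecMul_selection_transpose (e : Fin n → Fin m) (v : Fin m → ℝ) :
    Matrix.vecMul v (selection e).transpose = v ∘ e := by
  rw [Matrix.vecMul_transpose, selection_mulVec]

end Selection

theorem sdDiag_inv {ι : Type*} [Fintype ι] [DecidableEq ι] {S : Matrix ι ι ℝ}
    (hS : ∀ i, 0 < S i i) : (sdDiag S)⁻¹ = Matrix.diagonal fun i => (Real.sqrt (S i i))⁻¹ := by
  refine Matrix.inv_eq_right_inv ?_
  rw [sdDiag, Matrix.diagonal_mul_diagonal, ← Matrix.diagonal_one]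
  congr 1
  ext i
  exact mul_inv_cancel₀ (Real.sqrt_pos.2 (hS i)).ne'

/-! ### The posterior parameters in terms of covariances -/

namespace Params

variable {E κ : Type*}

/-- The matrix `D Δ(X)` of covariances of the observed and the latent coordinates. -/
noncomputable def crossCov (θ : Params E κ) {n : ℕ} (X : Fin n → E) : Matrix (Fin n) κ ℝ :=
  sdDiag (θ.scaleMat X) * θ.skewMat X

theorem crossCov_comp (θ : Params E κ) {m n : ℕ} (X : Fin m → E) (e : Fin n → Fin m) :
    θ.crossCov (X ∘ e) = (θ.crossCov X).submatrix e id := by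
  ext i j
  simp [crossCov, sdDiag, scaleMat, skewMat]

theorem Admissible.posDef [Fintype κ] [DecidableEq κ] {θ : Params E κ} (h : θ.Admissible) {n : ℕ}
    {X : Fin n → E} (hX : Function.Injective X) :
    (latentCov θ.Gamma (θ.crossCov X) (θ.scaleMat X)).PosDef :=
  posDef_corr_blocks_iff.1 (h n X hX)

end Params

namespace MixedData

variable {E κ : Type*} {n ma mr : ℕ}

theorem measurable_likelihood (𝒟 : MixedData E n ma mr) : Measurable 𝒟.likelihood :=
  ((measurable_normalCDF _).comp (Continuous.measurable (by fun_prop))).mul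
    ((continuous_normalPDF _).measurable.comp (Continuous.measurable (by fun_prop)))

variable (𝒟 : MixedData E n ma mr) (θ : Params E κ)

theorem sdDiag_mul_affSkewMat (hpos : ∀ i, 0 < θ.scaleMat 𝒟.X i i) :
    sdDiag (θ.scaleMat 𝒟.X) * 𝒟.affSkewMat θ =
      affCov (θ.crossCov 𝒟.X) (θ.scaleMat 𝒟.X) 𝒟.W := by
  have h := (Matrix.isUnit_iff_isUnit_det _).1 (isUnit_sdDiag hpos)
  rw [affSkewMat, Matrix.mul_fromCols, affCov, Params.crossCov, Matrix.mul_assoc,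
    Matrix.mul_nonsing_inv_cancel_left _ _ h]

theorem affSkewMat_apply (hpos : ∀ i, 0 < θ.scaleMat 𝒟.X i i) (i : Fin n) (j : κ ⊕ Fin ma) :
    𝒟.affSkewMat θ i j = 𝒟.affSkew θ (𝒟.X i) j := by
  rcases j with j | j
  · rfl
  · simp only [affSkewMat, affSkew, sdDiag_inv hpos, Matrix.fromCols_apply_inr, Sum.elim_inr,
      Matrix.mul_assoc, Matrix.diagonal_mul, Pi.smul_apply, smul_eq_mul]
    rfl

theorem postScaleMat_eq : 𝒟.postScaleMat θ = condCov (θ.scaleMat 𝒟.X) 𝒟.C 𝒟.R := by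
  rw [condCov, Matrix.mul_assoc (θ.scaleMat 𝒟.X)]
  rfl

theorem postLoc_eq : (fun i => 𝒟.postLoc θ (𝒟.X i)) = θ.locVec 𝒟.X +
    (θ.scaleMat 𝒟.X * 𝒟.gain θ).mulVec (𝒟.Y - 𝒟.C.mulVec (θ.locVec 𝒟.X)) := by
  rw [← Matrix.mulVec_mulVec]
  rfl

theorem postGamma_eq (hpos : ∀ i, 0 < θ.scaleMat 𝒟.X i i) :
    𝒟.postGamma θ = 𝒟.affGamma θ +
      ((affCov (θ.crossCov 𝒟.X) (θ.scaleMat 𝒟.X) 𝒟.W).transpose * (θ.scaleMat 𝒟.X)⁻¹).mulVec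
        ((fun i => 𝒟.postLoc θ (𝒟.X i)) - θ.locVec 𝒟.X) := by
  have h := (Matrix.isUnit_iff_isUnit_det _).1 (isUnit_sdDiag hpos)
  rw [postGamma, ← sdDiag_mul_affSkewMat 𝒟 θ hpos, corr_inv hpos, Matrix.transpose_mul,
    sdDiag_transpose]
  simp only [Matrix.mul_assoc, Matrix.mul_nonsing_inv _ h, Matrix.mul_one]

theorem affGammaMat_eq : 𝒟.affGammaMat θ =
    affLatentCov θ.Gamma (θ.crossCov 𝒟.X) (θ.scaleMat 𝒟.X) 𝒟.W 𝒟.Sig := by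
  rw [affGammaMat, affLatentCov, Params.crossCov, Matrix.transpose_mul, sdDiag_transpose,
    Matrix.mul_assoc 𝒟.W (sdDiag _)]

/-- The scalings in `Δ_p` are such that `D_Ω̃ Δ_p = Ω̃ Ω⁻¹ D B`; all correlation matrices then
cancel. -/
theorem postGammaMat_eq (hOm : (θ.scaleMat 𝒟.X).PosDef) (hOm' : (𝒟.postScaleMat θ).PosDef) :
    𝒟.postGammaMat θ = affLatentCov θ.Gamma (θ.crossCov 𝒟.X) (θ.scaleMat 𝒟.X) 𝒟.W 𝒟.Sig -
      (affCov (θ.crossCov 𝒟.X) (θ.scaleMat 𝒟.X) 𝒟.W).transpose * (θ.scaleMat 𝒟.X)⁻¹ *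
        affCov (θ.crossCov 𝒟.X) (θ.scaleMat 𝒟.X) 𝒟.W +
      (affCov (θ.crossCov 𝒟.X) (θ.scaleMat 𝒟.X) 𝒟.W).transpose * (θ.scaleMat 𝒟.X)⁻¹ *
        𝒟.postScaleMat θ * (θ.scaleMat 𝒟.X)⁻¹ *
        affCov (θ.crossCov 𝒟.X) (θ.scaleMat 𝒟.X) 𝒟.W := by
  have hpos : ∀ i, 0 < θ.scaleMat 𝒟.X i i := fun i => hOm.diag_pos
  have hpos' : ∀ i, 0 < 𝒟.postScaleMat θ i i := fun i => hOm'.diag_pos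
  have h := (Matrix.isUnit_iff_isUnit_det _).1 (isUnit_sdDiag hpos)
  have h' := (Matrix.isUnit_iff_isUnit_det _).1 (isUnit_sdDiag hpos')
  have hO' := (Matrix.isUnit_iff_isUnit_det _).1 hOm'.isUnit
  have hskew : sdDiag (𝒟.postScaleMat θ) * 𝒟.postSkewMat θ = 𝒟.postScaleMat θ *
      ((θ.scaleMat 𝒟.X)⁻¹ * affCov (θ.crossCov 𝒟.X) (θ.scaleMat 𝒟.X) 𝒟.W) := by
    rw [← sdDiag_mul_affSkewMat 𝒟 θ hpos, postSkewMat, corr_inv hpos]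
    conv_rhs => rw [← sdDiag_mul_corr_mul_sdDiag hpos']
    simp only [Matrix.mul_assoc, Matrix.nonsing_inv_mul_cancel_left _ _ h]
  have hB : (𝒟.affSkewMat θ).transpose * (corr (θ.scaleMat 𝒟.X))⁻¹ * 𝒟.affSkewMat θ =
      (affCov (θ.crossCov 𝒟.X) (θ.scaleMat 𝒟.X) 𝒟.W).transpose * (θ.scaleMat 𝒟.X)⁻¹ *
        affCov (θ.crossCov 𝒟.X) (θ.scaleMat 𝒟.X) 𝒟.W := by
    rw [← sdDiag_mul_affSkewMat 𝒟 θ hpos, corr_inv hpos, Matrix.transpose_mul, sdDiag_transpose]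
    simp only [Matrix.mul_assoc]
  have hΔ : (𝒟.postSkewMat θ).transpose * (corr (𝒟.postScaleMat θ))⁻¹ * 𝒟.postSkewMat θ =
      (sdDiag (𝒟.postScaleMat θ) * 𝒟.postSkewMat θ).transpose * (𝒟.postScaleMat θ)⁻¹ *
        (sdDiag (𝒟.postScaleMat θ) * 𝒟.postSkewMat θ) := by
    rw [corr_inv hpos', Matrix.transpose_mul, sdDiag_transpose]
    simp only [Matrix.mul_assoc]
  rw [postGammaMat, hB, hΔ, hskew, affGammaMat_eq, Matrix.transpose_mul, Matrix.transpose_mul,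
    transpose_eq_of_posDef hOm', transpose_eq_of_posDef hOm.inv]
  simp only [Matrix.mul_assoc, Matrix.nonsing_inv_mul_cancel_left _ _ hO']

/-- `Γ̃` as the conditional covariance of the extended latent vector. -/
theorem postGammaMat_eq_sub (hOm : (θ.scaleMat 𝒟.X).PosDef) (hR : 𝒟.R.PosDef) :
    𝒟.postGammaMat θ = affLatentCov θ.Gamma (θ.crossCov 𝒟.X) (θ.scaleMat 𝒟.X) 𝒟.W 𝒟.Sig -
      (affCov (θ.crossCov 𝒟.X) (θ.scaleMat 𝒟.X) 𝒟.W).transpose * (𝒟.gain θ * 𝒟.C) *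
        affCov (θ.crossCov 𝒟.X) (θ.scaleMat 𝒟.X) 𝒟.W := by
  have hO := (Matrix.isUnit_iff_isUnit_det _).1 hOm.isUnit
  have hOm' : (𝒟.postScaleMat θ).PosDef := 𝒟.postScaleMat_eq θ ▸ condCov_posDef hOm 𝒟.C hR
  rw [postGammaMat_eq 𝒟 θ hOm hOm', postScaleMat_eq, condCov, ← gain]
  simp only [Matrix.mul_sub, Matrix.sub_mul, Matrix.mul_assoc,
    Matrix.nonsing_inv_mul_cancel_left _ _ hO, Matrix.mul_nonsing_inv_cancel_left _ _ hO]
  abel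

/-- `γ̃` as the conditional mean of the extended latent vector. -/
theorem postGamma_eq_add (hOm : (θ.scaleMat 𝒟.X).PosDef) :
    𝒟.postGamma θ = 𝒟.affGamma θ +
      (affCov (θ.crossCov 𝒟.X) (θ.scaleMat 𝒟.X) 𝒟.W).transpose.mulVec
        ((𝒟.gain θ).mulVec (𝒟.Y - 𝒟.C.mulVec (θ.locVec 𝒟.X))) := by
  have hO := (Matrix.isUnit_iff_isUnit_det _).1 hOm.isUnit
  rw [postGamma_eq 𝒟 θ fun i => hOm.diag_pos, postLoc_eq, add_sub_cancel_left,
    Matrix.mulVec_mulVec, Matrix.mulVec_mulVec, Matrix.mul_assoc,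
    Matrix.nonsing_inv_mul_cancel_left _ _ hO]

/-- Multiplication by `D_Ω̃` removes the prefactor of `Δ̃`, and what remains is `D B` multiplied by
`Ω̃ Ω⁻¹ = 1 - Ω Cᵀ G C`. -/
theorem sdDiag_mul_postSkew (hOm : (θ.scaleMat 𝒟.X).PosDef) (hR : 𝒟.R.PosDef) :
    sdDiag (𝒟.postScaleMat θ) * (𝒟.postParams θ).skewMat 𝒟.X =
      𝒟.postScaleMat θ * (θ.scaleMat 𝒟.X)⁻¹ *
        affCov (θ.crossCov 𝒟.X) (θ.scaleMat 𝒟.X) 𝒟.W := by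
  have hpos : ∀ i, 0 < θ.scaleMat 𝒟.X i i := fun i => hOm.diag_pos
  have hO := (Matrix.isUnit_iff_isUnit_det _).1 hOm.isUnit
  have hOm' : (𝒟.postScaleMat θ).PosDef := 𝒟.postScaleMat_eq θ ▸ condCov_posDef hOm 𝒟.C hR
  have hrhs : 𝒟.postScaleMat θ * (θ.scaleMat 𝒟.X)⁻¹ *
      affCov (θ.crossCov 𝒟.X) (θ.scaleMat 𝒟.X) 𝒟.W =
      sdDiag (θ.scaleMat 𝒟.X) * 𝒟.affSkewMat θ - θ.scaleMat 𝒟.X *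
        (𝒟.gain θ * 𝒟.C * sdDiag (θ.scaleMat 𝒟.X) * 𝒟.affSkewMat θ) := by
    rw [Matrix.mul_assoc _ (sdDiag _), sdDiag_mul_affSkewMat 𝒟 θ hpos, postScaleMat_eq, condCov,
      ← gain]
    simp only [Matrix.sub_mul, Matrix.mul_assoc, Matrix.mul_nonsing_inv_cancel_left _ _ hO]
  rw [hrhs]
  ext i j
  have hsq : Real.sqrt (𝒟.postScaleMat θ i i) ≠ 0 := (Real.sqrt_pos.2 hOm'.diag_pos).ne'
  have hs : Real.sqrt (𝒟.postScale θ (𝒟.X i) (𝒟.X i)) = Real.sqrt (𝒟.postScaleMat θ i i) := rfl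
  have hs2 : Real.sqrt (θ.scale (𝒟.X i) (𝒟.X i)) = Real.sqrt (θ.scaleMat 𝒟.X i i) := rfl
  rw [Matrix.sub_apply, sdDiag, sdDiag, Matrix.diagonal_mul, Matrix.diagonal_mul,
    affSkewMat_apply 𝒟 θ hpos]
  simp only [Params.skewMat, postParams, Matrix.of_apply, postSkew, Pi.sub_apply, Pi.smul_apply,
    smul_eq_mul, hs, hs2]
  rw [mul_sub, ← mul_assoc, ← mul_assoc, mul_inv_cancel₀ hsq, one_mul,
    mul_inv_cancel_left₀ hsq]
  rfl

theorem isSunUpdate [Fintype κ] [DecidableEq κ] (hOm : (θ.scaleMat 𝒟.X).PosDef)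
    (hR : 𝒟.R.PosDef) :
    IsSunUpdate (θ.locVec 𝒟.X) (θ.scaleMat 𝒟.X) (θ.skewMat 𝒟.X) θ.gamma θ.Gamma 𝒟.W 𝒟.Z 𝒟.Sig
      𝒟.C 𝒟.Y 𝒟.R ((𝒟.postParams θ).locVec 𝒟.X) ((𝒟.postParams θ).scaleMat 𝒟.X)
      ((𝒟.postParams θ).skewMat 𝒟.X) (𝒟.postParams θ).gamma (𝒟.postParams θ).Gamma where
  loc := 𝒟.postLoc_eq θ
  scale := 𝒟.postScaleMat_eq θ
  skew := 𝒟.sdDiag_mul_postSkew θ hOm hR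
  gamma := 𝒟.postGamma_eq θ fun _ => hOm.diag_pos
  Gamma := 𝒟.postGammaMat_eq θ hOm (𝒟.postScaleMat_eq θ ▸ condCov_posDef hOm 𝒟.C hR)

/-! ### Independence of the parameters from the points at which the data are expressed -/

section Extend

variable {m : ℕ} (X : Fin m → E) (e : Fin n → Fin m)

/-- The same data, expressed at the points `X` instead of `X ∘ e`. -/
def extend : MixedData E m ma mr where
  X := X
  W := 𝒟.W * selection e
  Z := 𝒟.Z
  Sig := 𝒟.Sig
  C := 𝒟.C * selection e
  Y := 𝒟.Y
  R := 𝒟.R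

theorem extend_likelihood (v : Fin m → ℝ) :
    (𝒟.extend X e).likelihood v = 𝒟.likelihood (v ∘ e) := by
  simp only [likelihood, extend, ← Matrix.mulVec_mulVec, selection_mulVec]

variable {X e} (hXe : X ∘ e = 𝒟.X)
include hXe

theorem scaleMat_submatrix : (θ.scaleMat X).submatrix e e = θ.scaleMat 𝒟.X := by
  rw [← hXe]
  rfl

/-- The matrix to be inverted is the covariance of the observations, which only sees the kernel at
the original data points. -/
theorem extend_gain : (𝒟.extend X e).gain θ = (selection e).transpose * 𝒟.gain θ := by
  have h : 𝒟.C * selection e * θ.scaleMat X * ((selection e).transpose * 𝒟.C.transpose) =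
      𝒟.C * θ.scaleMat 𝒟.X * 𝒟.C.transpose := by
    rw [← scaleMat_submatrix 𝒟 θ hXe, ← Matrix.mul_assoc, Matrix.mul_assoc 𝒟.C, selection_mul,
      Matrix.mul_assoc 𝒟.C, mul_selection_transpose]
    rfl
  simp only [gain, extend, Matrix.transpose_mul, Matrix.mul_assoc] at h ⊢
  rw [h]

theorem extend_crossScale (x : E) :
    (𝒟.extend X e).crossScale θ x ∘ e = 𝒟.crossScale θ x := by
  ext i
  simp [crossScale, extend, ← hXe]

theorem locVec_comp : θ.locVec X ∘ e = θ.locVec 𝒟.X := by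
  rw [← hXe]
  rfl

theorem extend_residual : (𝒟.extend X e).Y - (𝒟.extend X e).C.mulVec (θ.locVec X) =
    𝒟.Y - 𝒟.C.mulVec (θ.locVec 𝒟.X) := by
  simp only [extend, ← Matrix.mulVec_mulVec, selection_mulVec, locVec_comp 𝒟 θ hXe]

theorem extend_affCov : selection e *
    affCov (θ.crossCov X) (θ.scaleMat X) (𝒟.extend X e).W =
      affCov (θ.crossCov 𝒟.X) (θ.scaleMat 𝒟.X) 𝒟.W := by
  have h : selection e * (θ.scaleMat X * (𝒟.W * selection e).transpose) =
      θ.scaleMat 𝒟.X * 𝒟.W.transpose := by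
    rw [← scaleMat_submatrix 𝒟 θ hXe, Matrix.transpose_mul, ← Matrix.mul_assoc,
      ← Matrix.mul_assoc, selection_mul, mul_selection_transpose]
    rfl
  rw [affCov, affCov, Matrix.mul_fromCols, extend, h, selection_mul, ← hXe, Params.crossCov_comp]

theorem extend_postLoc : (𝒟.extend X e).postLoc θ = 𝒟.postLoc θ := by
  ext x
  have h := extend_residual 𝒟 θ hXe
  rw [postLoc, postLoc]
  change _ + _ ⬝ᵥ ((𝒟.extend X e).gain θ).mulVec
    ((𝒟.extend X e).Y - (𝒟.extend X e).C.mulVec (θ.locVec X)) = _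
  rw [h, extend_gain 𝒟 θ hXe, ← Matrix.mulVec_mulVec, Matrix.dotProduct_mulVec,
    vecMul_selection_transpose, extend_crossScale 𝒟 θ hXe]

theorem extend_postScale : (𝒟.extend X e).postScale θ = 𝒟.postScale θ := by
  ext x x'
  have h : (𝒟.C * selection e).mulVec (fun i => θ.scale (X i) x') =
      𝒟.C.mulVec fun i => θ.scale (𝒟.X i) x' := by
    rw [← Matrix.mulVec_mulVec, selection_mulVec, ← hXe]
    rfl
  rw [postScale, postScale, extend_gain 𝒟 θ hXe, ← Matrix.mulVec_mulVec, ← Matrix.mulVec_mulVec,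
    ← Matrix.mulVec_mulVec, Matrix.dotProduct_mulVec, vecMul_selection_transpose,
    extend_crossScale 𝒟 θ hXe, ← h]
  rfl

theorem extend_affSkew : (𝒟.extend X e).affSkew θ = 𝒟.affSkew θ := by
  ext x
  rw [affSkew, affSkew, extend, Matrix.transpose_mul, ← Matrix.vecMul_vecMul]
  change Sum.elim _ (_ • Matrix.vecMul (Matrix.vecMul ((𝒟.extend X e).crossScale θ x) _) _) _ = _
  rw [vecMul_selection_transpose, extend_crossScale 𝒟 θ hXe]

/-- The scaled matrix `D B` is compared rather than `B`: its rows at the data points are selected by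
`extend_affCov`, and the new `C` reads no others. -/
theorem extend_postSkew (hpos : ∀ i, 0 < θ.scaleMat X i i) :
    (𝒟.extend X e).postSkew θ = 𝒟.postSkew θ := by
  have hpos' : ∀ i, 0 < θ.scaleMat 𝒟.X i i := by
    intro i
    rw [← scaleMat_submatrix 𝒟 θ hXe]
    exact hpos (e i)
  ext x : 1
  have h : (𝒟.extend X e).gain θ * (𝒟.extend X e).C *
      sdDiag (θ.scaleMat (𝒟.extend X e).X) * (𝒟.extend X e).affSkewMat θ =
      (selection e).transpose * (𝒟.gain θ * 𝒟.C * sdDiag (θ.scaleMat 𝒟.X) * 𝒟.affSkewMat θ) := by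
    rw [Matrix.mul_assoc _ (sdDiag _), sdDiag_mul_affSkewMat _ θ hpos,
      Matrix.mul_assoc _ (sdDiag _), sdDiag_mul_affSkewMat _ θ hpos', extend_gain 𝒟 θ hXe,
      ← extend_affCov 𝒟 θ hXe]
    simp only [extend, Matrix.mul_assoc]
  rw [postSkew, postSkew, extend_postScale 𝒟 θ hXe, extend_affSkew 𝒟 θ hXe, h,
    ← Matrix.vecMul_vecMul, vecMul_selection_transpose, extend_crossScale 𝒟 θ hXe]

theorem extend_affGamma : (𝒟.extend X e).affGamma θ = 𝒟.affGamma θ := by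
  simp only [affGamma, extend, ← Matrix.mulVec_mulVec, selection_mulVec, locVec_comp 𝒟 θ hXe]

/-- The defining formula contains the inverse of the kernel matrix, which does not restrict to
subsets of points. The conditional-mean form is free of it and meets the points only through
selected rows; the same device handles `Γ̃`. -/
theorem extend_postGamma (hOm : (θ.scaleMat X).PosDef) (hOm' : (θ.scaleMat 𝒟.X).PosDef) :
    (𝒟.extend X e).postGamma θ = 𝒟.postGamma θ := by
  have h := extend_residual 𝒟 θ hXe
  rw [postGamma_eq_add _ θ hOm, postGamma_eq_add _ θ hOm', extend_affGamma 𝒟 θ hXe,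
    ← extend_affCov 𝒟 θ hXe, extend_gain 𝒟 θ hXe, Matrix.transpose_mul, ← Matrix.mulVec_mulVec,
    ← Matrix.mulVec_mulVec, ← h]
  rfl

theorem extend_affLatentCov :
    affLatentCov θ.Gamma (θ.crossCov X) (θ.scaleMat X) (𝒟.extend X e).W 𝒟.Sig =
      affLatentCov θ.Gamma (θ.crossCov 𝒟.X) (θ.scaleMat 𝒟.X) 𝒟.W 𝒟.Sig := by
  have hK : selection e * θ.crossCov X = θ.crossCov 𝒟.X := by
    rw [selection_mul, ← hXe, Params.crossCov_comp]
  have hO : selection e * (θ.scaleMat X * (selection e).transpose) = θ.scaleMat 𝒟.X := by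
    rw [mul_selection_transpose, selection_mul, ← scaleMat_submatrix 𝒟 θ hXe]
    rfl
  rw [affLatentCov, affLatentCov, ← hK, ← hO]
  simp only [extend, Matrix.transpose_mul, Matrix.mul_assoc]

theorem extend_postGammaMat (hOm : (θ.scaleMat X).PosDef) (hOm' : (θ.scaleMat 𝒟.X).PosDef)
    (hR : 𝒟.R.PosDef) : (𝒟.extend X e).postGammaMat θ = 𝒟.postGammaMat θ := by
  rw [postGammaMat_eq_sub (𝒟.extend X e) θ hOm hR, postGammaMat_eq_sub _ θ hOm' hR, ← extend_affCov 𝒟 θ hXe,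
    extend_gain 𝒟 θ hXe, ← extend_affLatentCov 𝒟 θ hXe, Matrix.transpose_mul]
  simp only [extend, Matrix.mul_assoc]

/-- The posterior parameters do not depend on the points at which the data are expressed. -/
theorem extend_postParams (hOm : (θ.scaleMat X).PosDef) (hOm' : (θ.scaleMat 𝒟.X).PosDef)
    (hR : 𝒟.R.PosDef) : (𝒟.extend X e).postParams θ = 𝒟.postParams θ := by
  rw [postParams, postParams, extend_postLoc 𝒟 θ hXe, extend_postScale 𝒟 θ hXe,
    extend_postSkew 𝒟 θ hXe fun i => hOm.diag_pos, extend_postGamma 𝒟 θ hXe hOm hOm',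
    extend_postGammaMat 𝒟 θ hXe hOm hOm' hR]

end Extend

end MixedData

/-- Two tuples of points are both parts of a tuple of distinct points. -/
theorem exists_common_refinement {E : Type*} {m n : ℕ} (X : Fin m → E) {X' : Fin n → E}
    (hX' : Function.Injective X') :
    ∃ (N : ℕ) (X'' : Fin N → E) (e : Fin m → Fin N) (e' : Fin n → Fin N),
      Function.Injective X'' ∧ X'' ∘ e = X ∧ X'' ∘ e' = X' ∧ Function.Injective e' := by
  classical
  let S := Finset.univ.image X ∪ Finset.univ.image X'
  let f := S.equivFin
  have h (i : Fin m) : X i ∈ S := by simp [S]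
  have h' (i : Fin n) : X' i ∈ S := by simp [S]
  have hc : (fun i => (f.symm i : E)) ∘ (fun i => f ⟨X i, h i⟩) = X := by ext i; simp
  have hc' : (fun i => (f.symm i : E)) ∘ (fun i => f ⟨X' i, h' i⟩) = X' := by ext i; simp
  exact ⟨S.card, fun i => f.symm i, fun i => f ⟨X i, h i⟩, fun i => f ⟨X' i, h' i⟩,
    Subtype.val_injective.comp f.symm.injective, hc, hc',
    Function.Injective.of_comp (f := fun i => (f.symm i : E)) (by rwa [hc'])⟩

end SkewGP

/-! ### The posterior process -/

theorem theorem3 {d s n ma mr : ℕ} {T : Type*} [MeasurableSpace T] (P : MeasureTheory.Measure T)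
    (f : EuclideanSpace ℝ (Fin d) → T → ℝ)
    (θ : SkewGP.Params (EuclideanSpace ℝ (Fin d)) (Fin s))
    (prior : SkewGP.IsSkewGP f θ P)
    (𝒟 : SkewGP.MixedData (EuclideanSpace ℝ (Fin d)) n ma mr)
    (hX : Function.Injective 𝒟.X) (hSig : 𝒟.Sig.PosDef) (hR : 𝒟.R.PosDef) :
    SkewGP.IsSkewGP f (𝒟.postParams θ)
      (SkewGP.posterior P fun t => 𝒟.likelihood fun i => f (𝒟.X i) t) := by
  have hf := prior.measurable
  have key (k : ℕ) (X' : Fin k → EuclideanSpace ℝ (Fin d)) (hX' : Function.Injective X') :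
      (SkewGP.latentCov (𝒟.postParams θ).Gamma ((𝒟.postParams θ).crossCov X')
        ((𝒟.postParams θ).scaleMat X')).PosDef ∧
      (SkewGP.posterior P fun t => 𝒟.likelihood fun i => f (𝒟.X i) t).map
        (fun t i => f (X' i) t) = SkewGP.sun ((𝒟.postParams θ).locVec X')
          ((𝒟.postParams θ).scaleMat X') ((𝒟.postParams θ).skewMat X') (𝒟.postParams θ).gamma
          (𝒟.postParams θ).Gamma := by
    -- The update is carried out at points containing both the data points and `X'`; injectivity of
    -- `e'` allows the marginal at `X'` to be taken afterwards.
    obtain ⟨N, X, e, e', hXinj, he, he', heinj'⟩ := SkewGP.exists_common_refinement 𝒟.X hX'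
    have hM := prior.admissible.posDef hXinj
    have hOm : (θ.scaleMat X).PosDef := hM.submatrix Sum.inr_injective
    have hOm₀ : (θ.scaleMat 𝒟.X).PosDef :=
      (prior.admissible.posDef hX).submatrix Sum.inr_injective
    have hup := (𝒟.extend X e).isSunUpdate θ hOm hR
    rw [𝒟.extend_postParams θ he hOm hOm₀ hR] at hup
    have hM' : (SkewGP.latentCov (𝒟.postParams θ).Gamma ((𝒟.postParams θ).crossCov X)
      ((𝒟.postParams θ).scaleMat X)).PosDef := hup.posDef hM hSig hR
    have hlik : (fun t => 𝒟.likelihood fun i => f (𝒟.X i) t) =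
        fun t => (𝒟.extend X e).likelihood fun i => f (X i) t := by
      ext t
      rw [SkewGP.MixedData.extend_likelihood, ← he]
      rfl
    have hpost : (SkewGP.posterior P fun t => 𝒟.likelihood fun i => f (𝒟.X i) t).map
        (fun t i => f (X i) t) = SkewGP.sun ((𝒟.postParams θ).locVec X)
          ((𝒟.postParams θ).scaleMat X) ((𝒟.postParams θ).skewMat X) (𝒟.postParams θ).gamma
          (𝒟.postParams θ).Gamma := by
      rw [hlik, SkewGP.posterior_map P (measurable_pi_lambda _ fun i => hf (X i))
        (𝒟.extend X e).measurable_likelihood, prior.map_eq N X hXinj]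
      exact hup.posterior_sun hM hSig hR
    have hsub := SkewGP.sun_map_injective heinj' (ξ := (𝒟.postParams θ).locVec X)
      (γ := (𝒟.postParams θ).gamma) hM'
    have hinj : Function.Injective (Sum.map (id : Fin s ⊕ Fin ma → Fin s ⊕ Fin ma) e') :=
      Function.injective_id.sumMap heinj'
    have hMsub := hM'.submatrix hinj
    rw [SkewGP.Params.crossCov, SkewGP.latentCov_submatrix] at hMsub
    subst he'
    refine ⟨hMsub, ?_⟩
    rw [← hpost, MeasureTheory.Measure.map_map (by fun_prop)
      (measurable_pi_lambda _ fun i => hf (X i))] at hsub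
    exact hsub
  refine ⟨?_, hf, fun k X' hX' => SkewGP.posDef_corr_blocks_iff.2 (key k X' hX').1,
    fun k X' hX' => (key k X' hX').2⟩
  -- Pushforward preserves total mass, so a single finite-dimensional law shows that the posterior
  -- is a probability measure.
  obtain ⟨hM, hmap⟩ := key n 𝒟.X hX
  have hprob := SkewGP.sun_isProbabilityMeasure (ξ := (𝒟.postParams θ).locVec 𝒟.X)
    (γ := (𝒟.postParams θ).gamma) hM
  constructor
  have h1 := hprob.measure_univ
  rwa [← hmap, MeasureTheory.Measure.map_apply (measurable_pi_lambda _ fun i => hf (𝒟.X i))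
    MeasurableSet.univ, Set.preimage_univ] at h1
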